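/- A tree structure is a finite nonempty unranked ordered tree whose nodes interpret unary symbols; the binary symbols $\downarrow,\downarrow^+,\rightarrow,\rightarrow^+$ are interpreted as the child relation, its transitive closure, the right-sibling relation, and its transitive closure. Let $C^2[\downarrow,\downarrow^+,\rightarrow,\rightarrow^+]$ be the two-variable fragment of first-order logic with equality and counting quantifiers $\exists^{\ge n},\exists^{\le n}$ ($n\in\mathbb N$), over unary symbols and these four binary symbols. Let $$\varphi=\forall x\forall y\,\chi(x,y)\wedge\bigwedge_{i=1}^m \forall x\,\exists^{\bowtie_i C_i}y\,\chi_i(x,y),$$ where $m\ge 0$, $\bowtie_i\in\{\le,\ge\}$, $C_i\in\mathbb N$, and $\chi,\chi_i$ are quantifier-free formulas of this logic, be a formula in normal form. Let $C(\varphi)=\max_i C_i$ (with $C(\varphi)=0$ if $m=0$), and let $\boldsymbol\alpha_\varphi$ be the set of atomic $1$-types over the signature of the symbols appearing in $\varphi$, i.e. of maximal sets of atoms and negated atoms in the variable $x$ over this signature that are satisfied by some node of some tree structure. If $\varphi$ has a tree model, then it has a tree model in which every sequence of nodes $v_1,\dots,v_k$ with $v_i\downarrow v_{i+1}$ for all $i<k$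 has length $$k\le 3\,(C(\varphi)+2)^{10m+1}\,|\boldsymbol\alpha_\varphi|^2,$$ and in which every node has at most $$\bigl(4\,C(\varphi)^2+8\,C(\varphi)\bigr)\,|\boldsymbol\alpha_\varphi|^5$$ children. -/

import Mathlib

/-- The navigational binary symbols `↓`, `↓⁺`, `→`, `→⁺`. -/
inductive Nav where
  | down
  | downPlus
  | right
  | rightPlus

/-- The two variables of the logic. -/
inductive Var where
  | x
  | y

/-- Atomic formulas over the unary symbols `U` and the navigational symbols. -/
inductive Atom (U : Type*) where
  | unary (A : U) (v : Var)
  | nav (r : Nav) (v w : Var)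
  | eq (v w : Var)

/-- The formulas of the two-variable logic with counting quantifiers, with the navigational
symbols as the only binary symbols besides equality. -/
inductive Formula (U : Type*) where
  | atom (a : Atom U)
  | neg (φ : Formula U)
  | and (φ ψ : Formula U)
  | or (φ ψ : Formula U)
  | all (v : Var) (φ : Formula U)
  | ex (v : Var) (φ : Formula U)
  | existsGe (n : ℕ) (v : Var) (φ : Formula U)
  | existsLe (n : ℕ) (v : Var) (φ : Formula U)

/-- A finite unranked ordered tree, given by its nonempty finite tree domain: a node is the list
of the (0-based) indices of the children that lead to it from the root `[]`. -/
structure TreeFrame where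
  dom : Finset (List ℕ)
  root_mem : [] ∈ dom
  parent_mem : ∀ (u : List ℕ) (k : ℕ), u ++ [k] ∈ dom → u ∈ dom
  left_mem : ∀ (u : List ℕ) (k : ℕ), u ++ [k + 1] ∈ dom → u ++ [k] ∈ dom

namespace TreeFrame

/-- The nodes of a tree. -/
abbrev Node (T : TreeFrame) : Type := {u : List ℕ // u ∈ T.dom}

/-- `u ↓ w`: the node `w` is a child of `u`. -/
def Child (T : TreeFrame) (u w : T.Node) : Prop := ∃ k : ℕ, w.1 = u.1 ++ [k]

/-- `u → w`: the node `w` is the right sibling of `u`. -/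
def RightSibling (T : TreeFrame) (u w : T.Node) : Prop :=
  ∃ (p : List ℕ) (k : ℕ), u.1 = p ++ [k] ∧ w.1 = p ++ [k + 1]

/-- The interpretation of the navigational symbols. -/
def navRel (T : TreeFrame) : Nav → T.Node → T.Node → Prop
  | .down => T.Child
  | .downPlus => Relation.TransGen T.Child
  | .right => T.RightSibling
  | .rightPlus => Relation.TransGen T.RightSibling

/-- A `↓`-path `v₁, …, vₖ`: each node is followed by one of its children. -/
def IsDownPath (T : TreeFrame) (P : List T.Node) : Prop := P.IsChain T.Child

/-- The degree of a node: the number of its children. -/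
noncomputable def degree (T : TreeFrame) (v : T.Node) : ℕ := {w : T.Node | T.Child v w}.ncard

end TreeFrame

/-- A tree structure: a tree whose nodes interpret the unary symbols. -/
structure TreeStructure (U : Type*) extends TreeFrame where
  pred : U → toTreeFrame.Node → Prop

/-- The element assigned to a variable when `x ↦ a` and `y ↦ b`. -/
def Var.val {V : Type*} (a b : V) : Var → V
  | .x => a
  | .y => b

/-- Truth of an atom in `T` under `x ↦ a`, `y ↦ b`. -/
def Atom.Holds {U : Type*} (T : TreeStructure U) (a b : T.Node) : Atom U → Prop
  | .unary A v => T.pred A (v.val a b)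
  | .nav r v w => T.navRel r (v.val a b) (w.val a b)
  | .eq v w => v.val a b = w.val a b

namespace Formula

/-- Truth of a formula in `T` under `x ↦ a`, `y ↦ b`. -/
def Holds {U : Type*} (T : TreeStructure U) : Formula U → T.Node → T.Node → Prop
  | .atom p, a, b => p.Holds T a b
  | .neg φ, a, b => ¬ φ.Holds T a b
  | .and φ ψ, a, b => φ.Holds T a b ∧ ψ.Holds T a b
  | .or φ ψ, a, b => φ.Holds T a b ∨ ψ.Holds T a b
  | .all .x φ, _, b => ∀ c, φ.Holds T c b
  | .all .y φ, a, _ => ∀ c, φ.Holds T a c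
  | .ex .x φ, _, b => ∃ c, φ.Holds T c b
  | .ex .y φ, a, _ => ∃ c, φ.Holds T a c
  | .existsGe n .x φ, _, b => (n : ℕ∞) ≤ {c | φ.Holds T c b}.encard
  | .existsGe n .y φ, a, _ => (n : ℕ∞) ≤ {c | φ.Holds T a c}.encard
  | .existsLe n .x φ, _, b => {c | φ.Holds T c b}.encard ≤ (n : ℕ∞)
  | .existsLe n .y φ, a, _ => {c | φ.Holds T a c}.encard ≤ (n : ℕ∞)

/-- The formula has no quantifiers. -/
def IsQuantifierFree {U : Type*} : Formula U → Prop
  | .atom _ => True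
  | .neg φ => φ.IsQuantifierFree
  | .and φ ψ => φ.IsQuantifierFree ∧ ψ.IsQuantifierFree
  | .or φ ψ => φ.IsQuantifierFree ∧ ψ.IsQuantifierFree
  | .all _ _ => False
  | .ex _ _ => False
  | .existsGe _ _ _ => False
  | .existsLe _ _ _ => False

end Formula

/-- `T` is a model of the sentence `φ`. -/
def TreeStructure.Models {U : Type*} (T : TreeStructure U) (φ : Formula U) : Prop :=
  ∀ a b : T.Node, φ.Holds T a b

/-- `φ` has a finite tree model. -/
def Formula.Satisfiable {U : Type*} (φ : Formula U) : Prop :=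
  ∃ T : TreeStructure U, T.Models φ

/-- The symbols, other than equality, that occur in an atom. -/
def Atom.symbols {U : Type*} : Atom U → Set (U ⊕ Nav)
  | .unary A _ => {Sum.inl A}
  | .nav r _ _ => {Sum.inr r}
  | .eq _ _ => ∅

/-- The variables that occur in an atom. -/
def Atom.vars {U : Type*} : Atom U → Set Var
  | .unary _ v => {v}
  | .nav _ v w => {v, w}
  | .eq v w => {v, w}

/-- The symbols, other than equality, that appear in a formula. -/
def Formula.symbols {U : Type*} : Formula U → Set (U ⊕ Nav)
  | .atom a => a.symbols
  | .neg φ => φ.symbols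
  | .and φ ψ => φ.symbols ∪ ψ.symbols
  | .or φ ψ => φ.symbols ∪ ψ.symbols
  | .all _ φ => φ.symbols
  | .ex _ φ => φ.symbols
  | .existsGe _ _ φ => φ.symbols
  | .existsLe _ _ φ => φ.symbols

/-- The atoms and negated atoms in the variable `x` over the signature `σ`. -/
def literalsInX {U : Type*} (σ : Set (U ⊕ Nav)) : Set (Formula U) :=
  {ψ | ∃ a : Atom U, a.symbols ⊆ σ ∧ a.vars ⊆ {Var.x} ∧ (ψ = .atom a ∨ ψ = .neg (.atom a))}

/-- A set of formulas in the variable `x` is satisfied by some node of some tree. -/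
def SatisfiableInX {U : Type*} (S : Set (Formula U)) : Prop :=
  ∃ (T : TreeStructure U) (a : T.Node), ∀ ψ ∈ S, ψ.Holds T a a

/-- The atomic 1-types over `σ`: the maximal satisfiable sets of atoms or negated atoms in `x`. -/
def oneTypes {U : Type*} (σ : Set (U ⊕ Nav)) : Set (Set (Formula U)) :=
  {α | Maximal (fun S => S ⊆ literalsInX σ ∧ SatisfiableInX S) α}

/-- The two comparison signs of counting quantifiers. -/
inductive Cmp where
  | le
  | ge

/-- The data of a normal form formula
`∀x ∀y χ(x,y) ∧ ⋀_{i} ∀x ∃^{⋈_i C_i} y χ_i(x,y)`, with `m` counting conjuncts. -/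
structure NormalForm (U : Type*) where
  m : ℕ
  chi : Formula U
  chi_qf : chi.IsQuantifierFree
  cmp : Fin m → Cmp
  bound : Fin m → ℕ
  chiC : Fin m → Formula U
  chiC_qf : ∀ i, (chiC i).IsQuantifierFree

namespace NormalForm

/-- The conjunct `∀x ∃^{⋈_i C_i} y χ_i(x,y)`. -/
def conjunct {U : Type*} (φ : NormalForm U) (i : Fin φ.m) : Formula U :=
  match φ.cmp i with
  | .le => .all .x (.existsLe (φ.bound i) .y (φ.chiC i))
  | .ge => .all .x (.existsGe (φ.bound i) .y (φ.chiC i))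

/-- The normal form as a formula. -/
def toFormula {U : Type*} (φ : NormalForm U) : Formula U :=
  (List.ofFn φ.conjunct).foldl .and (.all .x (.all .y φ.chi))

/-- `C(φ)`, the largest of the numbers `C_i` (`0` if there are none). -/
def C {U : Type*} (φ : NormalForm U) : ℕ := Finset.univ.sup φ.bound

/-- The number of 1-types over the signature of the symbols that appear in the formula. -/
noncomputable def numOneTypes {U : Type*} (φ : NormalForm U) : ℕ :=
  (oneTypes φ.toFormula.symbols).ncard

end NormalForm

/-!
Take a model with the fewest nodes. If a path of it is long, two of its nodes `v` and `w` (below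
`v`) look alike: they have the same 1-type, for each counting conjunct equally many witnesses that
are not below them, and equally many nodes of each type below, above, and beside them, all numbers
being truncated at `C(φ) + 1`. As the last three kinds of numbers are monotone along the path, they
enter the bound on its length only linearly. Replacing the subtree at `v` by the one at `w` then
gives a smaller model: for every node of it, each node that got lost has `C(φ) + 1` surviving copies
of its type that stand in the same relations, and at the new node in place of `v` the witnesses
below are those of `w` while the other ones are those of `v`, which is as good as those of `w`.

Likewise, if a node has many children, two cuts between consecutive children look alike, and the
subtrees of the children between these cuts can be removed.
-/

/-! ### Addresses -/

/-- The navigational symbols interpreted on addresses, that is, in the infinite tree of all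
lists. -/
def Nav.Rel : Nav → List ℕ → List ℕ → Prop
  | .down, u, w => ∃ k, w = u ++ [k]
  | .downPlus, u, w => u <+: w ∧ u ≠ w
  | .right, u, w => ∃ p k, u = p ++ [k] ∧ w = p ++ [k + 1]
  | .rightPlus, u, w => ∃ p i j, i < j ∧ u = p ++ [i] ∧ w = p ++ [j]

namespace TreeFrame

theorem mem_of_append_mem (T : TreeFrame) {u t : List ℕ} : u ++ t ∈ T.dom → u ∈ T.dom := by
  induction t using List.reverseRecOn with
  | nil => simp
  | append_singleton t k ih => exact fun h => ih (T.parent_mem _ k (by simpa using h))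

theorem sibling_mem_of_le (T : TreeFrame) {u : List ℕ} {i j : ℕ} (hij : i ≤ j) :
    u ++ [j] ∈ T.dom → u ++ [i] ∈ T.dom := by
  induction hij with
  | refl => exact id
  | step _ ih => exact fun h => ih (T.left_mem _ _ h)

theorem transGen_child_iff (T : TreeFrame) (u w : T.Node) :
    Relation.TransGen T.Child u w ↔ u.1 <+: w.1 ∧ u.1 ≠ w.1 := by
  constructor
  · intro h
    induction h with
    | single h =>
      obtain ⟨k, hk⟩ := h
      simp [hk]
    | tail _ h ih =>
      obtain ⟨k, hk⟩ := h
      obtain ⟨⟨t, ht⟩, -⟩ := ih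
      simp [hk, ← ht]
  · obtain ⟨u, hu⟩ := u
    obtain ⟨w, hw⟩ := w
    rintro ⟨⟨t, rfl⟩, hne⟩
    induction t using List.reverseRecOn with
    | nil => simp at hne
    | append_singleton t k ih =>
      have hm : u ++ t ∈ T.dom := T.parent_mem _ k (by simpa using hw)
      rcases eq_or_ne t [] with rfl | ht
      · exact .single ⟨k, by simp⟩
      · exact .tail (ih hm (by simpa using ht)) ⟨k, by simp⟩

theorem transGen_rightSibling_iff (T : TreeFrame) (u w : T.Node) :
    Relation.TransGen T.RightSibling u w ↔
      ∃ p i j, i < j ∧ u.1 = p ++ [i] ∧ w.1 = p ++ [j] := by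
  constructor
  · intro h
    induction h with
    | single h =>
      obtain ⟨p, k, h₁, h₂⟩ := h
      exact ⟨p, k, k + 1, by simp, h₁, h₂⟩
    | tail _ h ih =>
      obtain ⟨p, k, h₁, h₂⟩ := h
      obtain ⟨q, i, j, hij, hi, hj⟩ := ih
      obtain ⟨rfl, hk⟩ := List.append_inj' (h₁.symm.trans hj) rfl
      simp only [List.cons.injEq, and_true] at hk
      exact ⟨p, i, k + 1, by omega, hi, h₂⟩
  · obtain ⟨u, hu⟩ := u
    obtain ⟨w, hw⟩ := w
    rintro ⟨p, i, j, hij, rfl, rfl⟩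
    induction hij with
    | refl => exact .single ⟨p, i, rfl, rfl⟩
    | step _ ih => exact .tail (ih (T.left_mem _ _ hw)) ⟨p, _, rfl, rfl⟩

theorem navRel_iff (T : TreeFrame) (r : Nav) (u w : T.Node) :
    T.navRel r u w ↔ r.Rel u.1 w.1 := by
  cases r
  · rfl
  · exact T.transGen_child_iff u w
  · rfl
  · exact T.transGen_rightSibling_iff u w

end TreeFrame

namespace Nav

theorem not_rel_self (r : Nav) (u : List ℕ) : ¬ r.Rel u u := by
  cases r
  · simp [Rel]
  · simp [Rel]
  · rintro ⟨p, k, h₁, h₂⟩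
    simpa using h₁.symm.trans h₂
  · rintro ⟨p, i, j, hij, h₁, h₂⟩
    have := h₁.symm.trans h₂
    simp only [List.append_cancel_left_eq, List.cons.injEq, and_true] at this
    omega

@[simp] theorem not_down_nil_right (u : List ℕ) : ¬ Nav.down.Rel u [] := by simp [Rel]

@[simp] theorem down_nil_cons (j : ℕ) (w : List ℕ) : Nav.down.Rel [] (j :: w) ↔ w = [] := by
  simp [Rel]

@[simp] theorem down_cons_cons (i j : ℕ) (u w : List ℕ) :
    Nav.down.Rel (i :: u) (j :: w) ↔ i = j ∧ Nav.down.Rel u w := by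
  simp [Rel, eq_comm]

@[simp] theorem not_downPlus_nil_right (u : List ℕ) : ¬ Nav.downPlus.Rel u [] := by simp [Rel]

@[simp] theorem downPlus_nil_cons (j : ℕ) (w : List ℕ) : Nav.downPlus.Rel [] (j :: w) := by
  simp [Rel]

@[simp] theorem downPlus_cons_cons (i j : ℕ) (u w : List ℕ) :
    Nav.downPlus.Rel (i :: u) (j :: w) ↔ i = j ∧ Nav.downPlus.Rel u w := by
  simp only [Rel, List.cons_prefix_cons, ne_eq, List.cons.injEq]
  tauto

@[simp] theorem not_right_nil_right (u : List ℕ) : ¬ Nav.right.Rel u [] := by simp [Rel]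

@[simp] theorem not_right_nil_left (u : List ℕ) : ¬ Nav.right.Rel [] u := by simp [Rel]

@[simp] theorem right_cons_cons (i j : ℕ) (u w : List ℕ) :
    Nav.right.Rel (i :: u) (j :: w) ↔
      (u = [] ∧ w = [] ∧ j = i + 1) ∨ (i = j ∧ Nav.right.Rel u w) := by
  constructor
  · rintro ⟨_ | ⟨l, p⟩, k, h₁, h₂⟩
    · simp_all
    · simp only [List.cons_append, List.cons.injEq] at h₁ h₂
      exact Or.inr ⟨h₁.1.trans h₂.1.symm, p, k, h₁.2, h₂.2⟩
  · rintro (⟨rfl, rfl, rfl⟩ | ⟨rfl, p, k, rfl, rfl⟩)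
    · exact ⟨[], i, rfl, rfl⟩
    · exact ⟨i :: p, k, rfl, rfl⟩

@[simp] theorem not_rightPlus_nil_right (u : List ℕ) : ¬ Nav.rightPlus.Rel u [] := by
  simp [Rel]

@[simp] theorem not_rightPlus_nil_left (u : List ℕ) : ¬ Nav.rightPlus.Rel [] u := by
  simp [Rel]

@[simp] theorem rightPlus_cons_cons (i j : ℕ) (u w : List ℕ) :
    Nav.rightPlus.Rel (i :: u) (j :: w) ↔
      (u = [] ∧ w = [] ∧ i < j) ∨ (i = j ∧ Nav.rightPlus.Rel u w) := by
  constructor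
  · rintro ⟨_ | ⟨l, p⟩, k, k', hk, h₁, h₂⟩
    · simp_all
    · simp only [List.cons_append, List.cons.injEq] at h₁ h₂
      exact Or.inr ⟨h₁.1.trans h₂.1.symm, p, k, k', hk, h₁.2, h₂.2⟩
  · rintro (⟨rfl, rfl, hij⟩ | ⟨rfl, p, k, k', hk, rfl, rfl⟩)
    · exact ⟨[], i, j, hij, rfl, rfl⟩
    · exact ⟨i :: p, k, k', hk, rfl, rfl⟩

end Nav

/-- The addresses strictly below `v`. -/
def strictDescendants (v : List ℕ) : Set (List ℕ) := {z | v <+: z ∧ z ≠ v}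

/-- The addresses strictly above `v`. -/
def strictAncestors (v : List ℕ) : Set (List ℕ) := {z | z <+: v ∧ z ≠ v}

/-- The addresses that are neither above nor below `v`, nor equal to it. -/
def incomparables (v : List ℕ) : Set (List ℕ) := {z | ¬ v <+: z ∧ ¬ z <+: v}

theorem strictDescendants_anti {v w : List ℕ} (h : v <+: w) :
    strictDescendants w ⊆ strictDescendants v := by
  rintro z ⟨hz, hne⟩
  exact ⟨h.trans hz, fun hzv => hne ((hzv ▸ h).eq_of_length_le hz.length_le)⟩

theorem strictAncestors_mono {v w : List ℕ} (h : v <+: w) :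
    strictAncestors v ⊆ strictAncestors w := by
  rintro z ⟨hz, hne⟩
  exact ⟨hz.trans h, fun hzw => hne (hz.eq_of_length_le (hzw ▸ h).length_le)⟩

theorem incomparables_mono {v w : List ℕ} (h : v <+: w) :
    incomparables v ⊆ incomparables w := by
  rintro z ⟨hvz, hzv⟩
  exact ⟨fun hwz => hvz (h.trans hwz), fun hzw =>
    (List.prefix_or_prefix_of_prefix h hzw).elim hvz hzv⟩

/-- The pairs `(u, w)` and `(a, b)` of addresses satisfy the same atoms of the forms `x = y`,
`x r y` and `y r x`, so that no quantifier-free formula tells them apart by the tree order. -/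
structure SameRel (u w a b : List ℕ) : Prop where
  eq_iff : u = w ↔ a = b
  rel_iff : ∀ r : Nav, r.Rel u w ↔ r.Rel a b
  rel_swap_iff : ∀ r : Nav, r.Rel w u ↔ r.Rel b a

namespace SameRel

variable {p s t u w a b c d : List ℕ}

theorem refl (u w : List ℕ) : SameRel u w u w := ⟨.rfl, fun _ => .rfl, fun _ => .rfl⟩

theorem symm (h : SameRel u w a b) : SameRel a b u w :=
  ⟨h.eq_iff.symm, fun r => (h.rel_iff r).symm, fun r => (h.rel_swap_iff r).symm⟩

theorem trans (h : SameRel u w a b) (h' : SameRel a b c d) : SameRel u w c d :=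
  ⟨h.eq_iff.trans h'.eq_iff, fun r => (h.rel_iff r).trans (h'.rel_iff r),
    fun r => (h.rel_swap_iff r).trans (h'.rel_swap_iff r)⟩

theorem swap (h : SameRel u w a b) : SameRel w u b a :=
  ⟨eq_comm.trans (h.eq_iff.trans eq_comm), h.rel_swap_iff, h.rel_iff⟩

theorem cons_cons (i : ℕ) (s t : List ℕ) : SameRel (i :: s) (i :: t) s t := by
  refine ⟨by simp, ?_, ?_⟩ <;> rintro (_ | _ | _ | _) <;> simp

theorem append_append (p s t : List ℕ) : SameRel (p ++ s) (p ++ t) s t := by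
  induction p with
  | nil => exact .refl _ _
  | cons i p ih => exact (cons_cons i _ _).trans ih

theorem append_left (p : List ℕ) (h : SameRel s t a b) :
    SameRel (p ++ s) (p ++ t) (p ++ a) (p ++ b) :=
  (append_append p s t).trans (h.trans (append_append p a b).symm)

theorem nil_cons (i j : ℕ) (hs : s = [] ↔ t = []) : SameRel [] (i :: s) [] (j :: t) := by
  refine ⟨by simp, ?_, ?_⟩ <;> rintro (_ | _ | _ | _) <;> simp [hs]

/-- Addresses with distinct heads are related at most as siblings, in which case both are
singletons. -/
theorem cons_of_ne {i j k l : ℕ} (hij : i ≠ j) (hkl : k ≠ l)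
    (hst : s = [] ∧ t = [] ↔ a = [] ∧ b = [])
    (horder : s = [] → t = [] →
      (i < j ↔ k < l) ∧ (j = i + 1 ↔ l = k + 1) ∧ (i = j + 1 ↔ k = l + 1)) :
    SameRel (i :: s) (j :: t) (k :: a) (l :: b) := by
  by_cases hnil : s = [] ∧ t = []
  · obtain ⟨rfl, rfl⟩ := hst.1 hnil
    obtain ⟨rfl, rfl⟩ := hnil
    obtain ⟨hlt, hsucc, hpred⟩ := horder rfl rfl
    have hgt : j < i ↔ l < k := by omega
    refine ⟨by simp [hij, hkl], ?_, ?_⟩ <;> rintro (_ | _ | _ | _) <;>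
      simp [hij, hkl, hij.symm, hkl.symm, hlt, hsucc, hpred, hgt]
  · have hnil' := mt hst.2 hnil
    refine ⟨by simp [hij, hkl], ?_, ?_⟩ <;> rintro (_ | _ | _ | _) <;>
      simp [hij, hkl, hij.symm, hkl.symm] <;> tauto

theorem of_not_prefix {v : List ℕ} (hu : ¬ v <+: u) (hs : s ≠ []) (ht : t ≠ []) :
    SameRel u (v ++ s) u (v ++ t) := by
  induction v generalizing u with
  | nil => simp at hu
  | cons i v ih =>
    cases u with
    | nil => exact nil_cons i i (by simp [hs, ht])
    | cons j u =>
      by_cases hji : j = i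
      · subst hji
        exact append_left [j] (ih (by simpa using hu))
      · exact cons_of_ne hji hji (by simp [hs, ht]) (by simp [hs])

theorem of_mem_strictAncestors (hu : u ∈ strictAncestors a) (hs : s ≠ []) :
    SameRel (a ++ s) u [0, 0] [] := by
  obtain ⟨⟨r, rfl⟩, hr⟩ := hu
  have hcanonical : SameRel (r ++ s) [] [0, 0] [] := by
    match r, s, hs with
    | [], _, _ => simp at hr
    | i :: r, j :: s, _ =>
      refine ⟨by simp, ?_, ?_⟩ <;> rintro (_ | _ | _ | _) <;> simp
  simpa using (append_append u (r ++ s) []).trans hcanonical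

theorem of_mem_incomparables (hu : u ∈ incomparables a) (hs : s ≠ []) :
    SameRel (a ++ s) u [0, 0] [1] := by
  obtain ⟨hau, hua⟩ := hu
  induction a generalizing u with
  | nil => simp at hau
  | cons i a ih =>
    cases u with
    | nil => simp at hua
    | cons j u =>
      by_cases hij : i = j
      · subst hij
        exact (cons_cons i _ _).trans (ih (by simpa using hau) (by simpa using hua))
      · exact cons_of_ne hij (by simp) (by simp [hs]) (by simp [hs])

theorem of_strict_grandchildren {j l : ℕ} (hs : s ≠ []) (ht : t ≠ [])
    (hu : ∀ i r, u = p ++ i :: r → i ≠ j ∧ i ≠ l) :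
    SameRel u (p ++ j :: s) u (p ++ l :: t) := by
  by_cases hp : p <+: u
  · obtain ⟨_ | ⟨i, r⟩, rfl⟩ := hp
    · exact append_left p (nil_cons j l (by simp [hs, ht]))
    · obtain ⟨hj, hl⟩ := hu i r rfl
      exact append_left p (cons_of_ne hj hl (by simp [hs, ht]) (by simp [hs]))
  · exact of_not_prefix hp (by simp) (by simp)

theorem of_children {j l : ℕ}
    (hu : ∀ i r, u = p ++ i :: r → i ≠ j ∧ i ≠ l ∧
      (r = [] → (i + 1 < j ∧ i + 1 < l) ∨ (j + 1 < i ∧ l + 1 < i))) :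
    SameRel u (p ++ [j]) u (p ++ [l]) := by
  by_cases hp : p <+: u
  · obtain ⟨_ | ⟨i, r⟩, rfl⟩ := hp
    · exact append_left p (nil_cons j l .rfl)
    · obtain ⟨hj, hl, hfar⟩ := hu i r rfl
      refine append_left p (cons_of_ne hj hl .rfl fun hr _ => ?_)
      have := hfar hr
      omega
  · exact of_not_prefix hp (by simp) (by simp)

theorem cons_add_cons_add (i j d : ℕ) (s t : List ℕ) :
    SameRel (i :: s) (j :: t) ((i + d) :: s) ((j + d) :: t) := by
  by_cases hij : i = j
  · subst hij
    exact (cons_cons i s t).trans (cons_cons (i + d) s t).symm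
  · exact cons_of_ne hij (by omega) .rfl (by omega)

end SameRel

/-! ### Types and truth of quantifier-free formulas -/

theorem Formula.symbols_finite {U : Type*} (φ : Formula U) : φ.symbols.Finite := by
  induction φ with
  | atom a => cases a <;> simp [Formula.symbols, Atom.symbols]
  | and _ _ h₁ h₂ | or _ _ h₁ h₂ => exact h₁.union h₂
  | neg _ ih | all _ _ ih | ex _ _ ih | existsGe _ _ _ ih | existsLe _ _ _ ih => exact ih

theorem literalsInX_finite {U : Type*} {σ : Set (U ⊕ Nav)} (hσ : σ.Finite) :
    (literalsInX σ).Finite := by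
  have hatoms : {a : Atom U | a.symbols ⊆ σ ∧ a.vars ⊆ {Var.x}}.Finite := by
    let f : Option (U ⊕ Nav) → Atom U
      | none => .eq .x .x
      | some (.inl A) => .unary A .x
      | some (.inr r) => .nav r .x .x
    refine (((hσ.image some).insert none).image f).subset ?_
    rintro (⟨A, v⟩ | ⟨r, v, w⟩ | ⟨v, w⟩) ⟨hσ, hx⟩
    · obtain rfl : v = .x := by simpa [Atom.vars] using hx
      exact ⟨some (.inl A), by simpa [Atom.symbols] using hσ, rfl⟩
    · obtain ⟨rfl, rfl⟩ : v = .x ∧ w = .x := by simpa [Atom.vars, Set.insert_subset_iff] using hx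
      exact ⟨some (.inr r), by simpa [Atom.symbols] using hσ, rfl⟩
    · obtain ⟨rfl, rfl⟩ : v = .x ∧ w = .x := by simpa [Atom.vars, Set.insert_subset_iff] using hx
      exact ⟨none, by simp, rfl⟩
  refine ((hatoms.image Formula.atom).union (hatoms.image fun a => .neg (.atom a))).subset ?_
  rintro ψ ⟨a, hσ, hx, rfl | rfl⟩
  · exact Or.inl ⟨a, ⟨hσ, hx⟩, rfl⟩
  · exact Or.inr ⟨a, ⟨hσ, hx⟩, rfl⟩

theorem oneTypes_finite {U : Type*} {σ : Set (U ⊕ Nav)} (hσ : σ.Finite) : (oneTypes σ).Finite :=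
  (literalsInX_finite hσ).finite_subsets.subset fun _ h => h.1.1

section Types

variable {U : Type*} {σ : Set (U ⊕ Nav)} {T T' : TreeStructure U}

theorem TreeStructure.setOf_literals_mem_oneTypes (T : TreeStructure U) (v : T.Node) :
    {ψ | ψ ∈ literalsInX σ ∧ ψ.Holds T v v} ∈ oneTypes σ := by
  refine ⟨⟨fun ψ h => h.1, T, v, fun ψ h => h.2⟩, ?_⟩
  rintro S ⟨hS, T', _, ha⟩ hle ψ hψ
  refine ⟨hS hψ, by_contra fun hn => ?_⟩
  obtain ⟨p, hp, hx, rfl | rfl⟩ := hS hψ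
  · exact ha _ (hle ⟨⟨p, hp, hx, Or.inr rfl⟩, hn⟩) (ha _ hψ)
  · exact ha _ hψ (ha _ (hle ⟨⟨p, hp, hx, Or.inl rfl⟩, not_not.1 hn⟩))

variable (σ) in
/-- The 1-type over `σ` of a node. -/
def TreeStructure.oneType (T : TreeStructure U) (v : T.Node) : oneTypes σ :=
  ⟨{ψ | ψ ∈ literalsInX σ ∧ ψ.Holds T v v}, T.setOf_literals_mem_oneTypes v⟩

namespace TreeStructure

theorem pred_iff_of_oneType_eq {u : T'.Node} {a : T.Node} (h : T'.oneType σ u = T.oneType σ a)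
    {A : U} (hA : Sum.inl A ∈ σ) : T'.pred A u ↔ T.pred A a := by
  have hlit : Formula.atom (.unary A .x) ∈ literalsInX σ :=
    ⟨.unary A .x, by simpa [Atom.symbols] using hA, by simp [Atom.vars], Or.inl rfl⟩
  have hmem := Set.ext_iff.1 (congrArg Subtype.val h) (.atom (.unary A .x))
  exact (and_iff_right hlit).symm.trans (hmem.trans (and_iff_right hlit))

theorem oneType_eq_of_pred_iff {u : T'.Node} {a : T.Node}
    (h : ∀ A, Sum.inl A ∈ σ → (T'.pred A u ↔ T.pred A a)) :
    T'.oneType σ u = T.oneType σ a := by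
  have hatom : ∀ p : Atom U, p.symbols ⊆ σ → (p.Holds T' u u ↔ p.Holds T a a) := by
    rintro (⟨A, v⟩ | ⟨r, v, w⟩ | ⟨v, w⟩) hp
    · have := h A (by simpa [Atom.symbols] using hp)
      cases v <;> simpa only [Atom.Holds, Var.val] using this
    · cases v <;> cases w <;>
        simp [Atom.Holds, Var.val, TreeFrame.navRel_iff, Nav.not_rel_self]
    · cases v <;> cases w <;> simp [Atom.Holds, Var.val]
  refine Subtype.ext (Set.ext fun ψ => and_congr_right ?_)
  rintro ⟨p, hp, -, rfl | rfl⟩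
  · exact hatom p hp
  · exact not_congr (hatom p hp)

end TreeStructure

variable (σ) in
/-- Two pairs of nodes satisfy the same atoms over `σ`. -/
def Agree (T' : TreeStructure U) (u u' : T'.Node) (T : TreeStructure U) (a a' : T.Node) : Prop :=
  ∀ p : Atom U, p.symbols ⊆ σ → (p.Holds T' u u' ↔ p.Holds T a a')

namespace Agree

variable {u u' : T'.Node} {a a' : T.Node}

theorem of_oneType_eq (h : T'.oneType σ u = T.oneType σ a) (h' : T'.oneType σ u' = T.oneType σ a')
    (hr : SameRel u.1 u'.1 a.1 a'.1) : Agree σ T' u u' T a a' := by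
  rintro (⟨A, v⟩ | ⟨r, v, w⟩ | ⟨v, w⟩) hp
  · have hA : Sum.inl A ∈ σ := by simpa [Atom.symbols] using hp
    cases v
    · exact TreeStructure.pred_iff_of_oneType_eq h hA
    · exact TreeStructure.pred_iff_of_oneType_eq h' hA
  · cases v <;> cases w <;>
      simp [Atom.Holds, Var.val, TreeFrame.navRel_iff, Nav.not_rel_self, hr.rel_iff r,
        hr.rel_swap_iff r]
  · have heq : u = u' ↔ a = a' := Subtype.ext_iff.trans (hr.eq_iff.trans Subtype.ext_iff.symm)
    cases v <;> cases w <;> simp [Atom.Holds, Var.val, heq, eq_comm (a := u'), eq_comm (a := a')]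

theorem holds_iff (h : Agree σ T' u u' T a a') {χ : Formula U} (hq : χ.IsQuantifierFree)
    (hχ : χ.symbols ⊆ σ) : χ.Holds T' u u' ↔ χ.Holds T a a' := by
  induction χ with
  | atom p => exact h p hχ
  | neg φ ih => exact not_congr (ih hq hχ)
  | and φ ψ h₁ h₂ =>
    exact and_congr (h₁ hq.1 (Set.subset_union_left.trans hχ))
      (h₂ hq.2 (Set.subset_union_right.trans hχ))
  | or φ ψ h₁ h₂ =>
    exact or_congr (h₁ hq.1 (Set.subset_union_left.trans hχ))
      (h₂ hq.2 (Set.subset_union_right.trans hχ))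
  | all | ex | existsGe | existsLe => exact hq.elim

end Agree

namespace TreeStructure

variable (σ) in
/-- The number of nodes of type `α` with an address in `S`. -/
noncomputable def count (T : TreeStructure U) (S : Set (List ℕ)) (α : oneTypes σ) : ℕ :=
  {z : T.Node | z.1 ∈ S ∧ T.oneType σ z = α}.ncard

variable {S S' : Set (List ℕ)}

theorem count_mono (h : S ⊆ S') (α : oneTypes σ) : T.count σ S α ≤ T.count σ S' α :=
  Set.ncard_le_ncard (fun _ hz => ⟨h hz.1, hz.2⟩) (Set.toFinite _)

variable (σ) in
/-- The sets `S` and `S'` of addresses contain, up to the threshold `k`, equally many nodes of each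
type. -/
def SameCounts (T : TreeStructure U) (k : ℕ) (S S' : Set (List ℕ)) : Prop :=
  ∀ α : oneTypes σ, min k (T.count σ S α) = min k (T.count σ S' α)

variable {k : ℕ}

theorem SameCounts.symm (h : T.SameCounts σ k S S') : T.SameCounts σ k S' S :=
  fun α => (h α).symm

/-- Since the subset `S` misses `z`, the truncated counts can only agree at the threshold. -/
theorem SameCounts.le_count (h : T.SameCounts σ k S S') (hS : S ⊆ S') {z : T.Node}
    (hz : z.1 ∈ S') (hzS : z.1 ∉ S) : k ≤ T.count σ S (T.oneType σ z) := by
  have hlt : T.count σ S (T.oneType σ z) < T.count σ S' (T.oneType σ z) :=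
    Set.ncard_lt_ncard ⟨fun _ hx => ⟨hS hx.1, hx.2⟩, fun hsub => hzS (hsub ⟨hz, rfl⟩).1⟩
      (Set.toFinite _)
  have := h (T.oneType σ z)
  omega

end TreeStructure

end Types

/-! ### Normal forms -/

namespace Formula

variable {U : Type*}

theorem holds_foldl_and (T : TreeStructure U) (L : List (Formula U)) (ψ : Formula U)
    (a b : T.Node) :
    (L.foldl .and ψ).Holds T a b ↔ ψ.Holds T a b ∧ ∀ θ ∈ L, θ.Holds T a b := by
  induction L generalizing ψ with
  | nil => simp
  | cons θ L ih => simp [ih, Holds, and_assoc]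

theorem symbols_foldl_and (L : List (Formula U)) (ψ : Formula U) :
    (L.foldl .and ψ).symbols = ψ.symbols ∪ {s | ∃ θ ∈ L, s ∈ θ.symbols} := by
  induction L generalizing ψ with
  | nil => simp
  | cons θ L ih =>
    ext s
    simp [ih, symbols, or_assoc]

end Formula

/-- The comparison `n ⋈ c` of a number `n` of witnesses with a bound `c`. -/
def Cmp.Sat : Cmp → ℕ → ℕ → Prop
  | .le, c, n => n ≤ c
  | .ge, c, n => c ≤ n

theorem Cmp.sat_iff_of_min_eq {C c n n' : ℕ} (r : Cmp) (hc : c ≤ C)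
    (h : min (C + 1) n = min (C + 1) n') : r.Sat c n ↔ r.Sat c n' := by
  cases r <;> simp only [Sat] <;> omega

namespace NormalForm

variable {U : Type*} (φ : NormalForm U)

theorem bound_le_C (i : Fin φ.m) : φ.bound i ≤ φ.C :=
  Finset.le_sup (f := φ.bound) (Finset.mem_univ i)

theorem numOneTypes_eq_card : φ.numOneTypes = Nat.card (oneTypes φ.toFormula.symbols) :=
  (Nat.card_coe_set_eq _).symm

instance finite_oneTypes : Finite (oneTypes φ.toFormula.symbols) :=
  oneTypes_finite φ.toFormula.symbols_finite

theorem symbols_chi_subset : φ.chi.symbols ⊆ φ.toFormula.symbols := by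
  rw [toFormula, Formula.symbols_foldl_and]
  exact Set.subset_union_left

theorem symbols_chiC_subset (i : Fin φ.m) : (φ.chiC i).symbols ⊆ φ.toFormula.symbols := by
  rw [toFormula, Formula.symbols_foldl_and]
  refine fun s hs => Or.inr ⟨φ.conjunct i, by simp only [List.mem_ofFn, exists_apply_eq_apply], ?_⟩
  unfold conjunct
  cases φ.cmp i <;> exact hs

theorem models_iff (T : TreeStructure U) :
    T.Models φ.toFormula ↔ (∀ a b, φ.chi.Holds T a b) ∧
      ∀ i a, (φ.cmp i).Sat (φ.bound i) {b | (φ.chiC i).Holds T a b}.ncard := by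
  have hconj : ∀ i a b, (φ.conjunct i).Holds T a b ↔
      ∀ a, (φ.cmp i).Sat (φ.bound i) {b | (φ.chiC i).Holds T a b}.ncard := by
    intro i a b
    unfold conjunct
    cases φ.cmp i <;>
      simp only [Formula.Holds, Cmp.Sat, ← (Set.toFinite _).cast_ncard_eq, Nat.cast_le]
  have hroot : Nonempty T.Node := ⟨⟨[], T.root_mem⟩⟩
  simp only [TreeStructure.Models, toFormula, Formula.holds_foldl_and, List.mem_ofFn,
    Formula.Holds, forall_exists_index, forall_apply_eq_imp_iff, hconj, forall_const]

/-- Up to the threshold `C(φ) + 1`, the node `u` of `T'` has as many witnesses for each counting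
conjunct as the node `a` of `T`. -/
def SameWitnessCounts (T' : TreeStructure U) (u : T'.Node) (T : TreeStructure U) (a : T.Node) :
    Prop :=
  ∀ i, min (φ.C + 1) {b | (φ.chiC i).Holds T' u b}.ncard =
    min (φ.C + 1) {b | (φ.chiC i).Holds T a b}.ncard

variable {φ}

theorem models_of_agree {T T' : TreeStructure U} (hT : T.Models φ.toFormula)
    (hpair : ∀ u u' : T'.Node, ∃ a a' : T.Node, Agree φ.toFormula.symbols T' u u' T a a')
    (hcount : ∀ u : T'.Node, ∃ a : T.Node, φ.SameWitnessCounts T' u T a) :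
    T'.Models φ.toFormula := by
  rw [models_iff] at hT ⊢
  refine ⟨fun u u' => ?_, fun i u => ?_⟩
  · obtain ⟨a, a', h⟩ := hpair u u'
    exact (h.holds_iff φ.chi_qf φ.symbols_chi_subset).2 (hT.1 a a')
  · obtain ⟨a, h⟩ := hcount u
    exact ((φ.cmp i).sat_iff_of_min_eq (φ.bound_le_C i) (h i)).2 (hT.2 i a)

end NormalForm

/-! ### Renaming nodes -/

/-- Apply `f` to the part of an address that follows the prefix `v`. -/
def liftAt (v : List ℕ) (f : List ℕ → List ℕ) (u : List ℕ) : List ℕ :=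
  if v <+: u then v ++ f (u.drop v.length) else u

section LiftAt

variable {v : List ℕ} {f : List ℕ → List ℕ}

@[simp] theorem liftAt_append (t : List ℕ) : liftAt v f (v ++ t) = v ++ f t := by
  simp [liftAt]

theorem liftAt_of_not_prefix {u : List ℕ} (h : ¬ v <+: u) : liftAt v f u = u := by
  simp [liftAt, h]

theorem prefix_liftAt_iff {u : List ℕ} : v <+: liftAt v f u ↔ v <+: u := by
  by_cases h : v <+: u
  · obtain ⟨t, rfl⟩ := h
    simp
  · rw [liftAt_of_not_prefix h]

theorem liftAt_injective (hf : f.Injective) : (liftAt v f).Injective := by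
  intro a b hab
  have hp : v <+: a ↔ v <+: b := by
    rw [← prefix_liftAt_iff (f := f), hab, prefix_liftAt_iff]
  by_cases h : v <+: a
  · obtain ⟨t, rfl⟩ := h
    obtain ⟨t', rfl⟩ := hp.1 ⟨t, rfl⟩
    simp only [liftAt_append, List.append_cancel_left_eq] at hab
    rw [hf hab]
  · rwa [liftAt_of_not_prefix h, liftAt_of_not_prefix (fun h' => h (hp.2 h'))] at hab

theorem mem_range_liftAt_of_not_prefix {u : List ℕ} (h : ¬ v <+: u) :
    u ∈ Set.range (liftAt v f) :=
  ⟨u, liftAt_of_not_prefix h⟩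

end LiftAt

section Update

variable {ι β : Type*} [DecidableEq ι] {g : ι → β}

theorem mem_range_update_iff (hg : g.Injective) {i : ι} {b z : β} :
    z ∈ Set.range (Function.update g i b) ↔ z = b ∨ z ∈ Set.range g ∧ z ≠ g i := by
  constructor
  · rintro ⟨j, rfl⟩
    by_cases hj : j = i
    · exact Or.inl (by rw [hj, Function.update_self])
    · rw [Function.update_of_ne hj]
      exact Or.inr ⟨⟨j, rfl⟩, hg.ne hj⟩
  · rintro (rfl | ⟨⟨j, rfl⟩, hj⟩)
    · exact ⟨i, Function.update_self ..⟩
    · exact ⟨j, Function.update_of_ne (fun h => hj (congrArg g h)) ..⟩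

theorem injective_update (hg : g.Injective) {i : ι} {b : β} (hb : b ∉ Set.range g) :
    (Function.update g i b).Injective := by
  have hne : ∀ j, j ≠ i → Function.update g i b j ≠ b := fun j hj h =>
    hb ⟨j, by rw [← h, Function.update_of_ne hj]⟩
  intro j l h
  by_cases hj : j = i <;> by_cases hl : l = i
  · rw [hj, hl]
  · rw [hj, Function.update_self] at h
    exact (hne l hl h.symm).elim
  · rw [hl, Function.update_self] at h
    exact (hne j hj h).elim
  · rw [Function.update_of_ne hj, Function.update_of_ne hl] at h
    exact hg h

end Update

namespace TreeStructure

variable {U : Type*} {σ : Set (U ⊕ Nav)} {T T' : TreeStructure U} {g h : List ℕ → List ℕ}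

variable (σ) in
/-- `T'` is obtained from `T` by renaming the nodes along `h` and dropping those outside the range
of `h`; the 1-types over `σ` are kept, the tree order need not be. -/
structure IsComap (T' T : TreeStructure U) (h : List ℕ → List ℕ) : Prop where
  injective : h.Injective
  mem_iff : ∀ u, u ∈ T'.dom ↔ h u ∈ T.dom
  oneType_eq : ∀ u : T'.Node, T'.oneType σ u = T.oneType σ ⟨h u.1, (mem_iff u.1).1 u.2⟩

theorem exists_isComap (T : TreeStructure U) (hh : h.Injective) (hroot : h [] ∈ T.dom)
    (hparent : ∀ u k, h (u ++ [k]) ∈ T.dom → h u ∈ T.dom)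
    (hleft : ∀ u k, h (u ++ [k + 1]) ∈ T.dom → h (u ++ [k]) ∈ T.dom) :
    ∃ T' : TreeStructure U, IsComap σ T' T h := by
  have hmem : ∀ u, u ∈ T.dom.preimage h hh.injOn ↔ h u ∈ T.dom := fun _ => Finset.mem_preimage
  refine ⟨⟨⟨T.dom.preimage h hh.injOn, ?_, ?_, ?_⟩,
    fun A u => T.pred A ⟨h u.1, (hmem u.1).1 u.2⟩⟩, hh, hmem, fun u =>
      oneType_eq_of_pred_iff fun A _ => Iff.rfl⟩
  · exact (hmem _).2 hroot
  · exact fun u k hu => (hmem _).2 (hparent u k ((hmem _).1 hu))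
  · exact fun u k hu => (hmem _).2 (hleft u k ((hmem _).1 hu))

theorem exists_isComap_liftAt (T : TreeStructure U) {v : List ℕ} {f : List ℕ → List ℕ}
    (hf : f.Injective) (hroot : v ++ f [] ∈ T.dom)
    (hparent : ∀ t k, v ++ f (t ++ [k]) ∈ T.dom → v ++ f t ∈ T.dom)
    (hleft : ∀ t k, v ++ f (t ++ [k + 1]) ∈ T.dom → v ++ f (t ++ [k]) ∈ T.dom) :
    ∃ T' : TreeStructure U, IsComap σ T' T (liftAt v f) := by
  have hv : v ∈ T.dom := T.mem_of_append_mem hroot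
  have below : ∀ {u : List ℕ} {k : ℕ}, ¬ v <+: u → v <+: u ++ [k] → v = u ++ [k] :=
    fun hu h => (List.prefix_concat_iff.1 h).resolve_right hu
  refine T.exists_isComap (liftAt_injective hf) ?_ (fun u k h => ?_) (fun u k h => ?_)
  · by_cases hnil : v = []
    · subst hnil
      simpa [liftAt] using hroot
    · rw [liftAt_of_not_prefix (by simpa using hnil)]
      exact T.root_mem
  · by_cases hu : v <+: u
    · obtain ⟨t, rfl⟩ := hu
      simp only [List.append_assoc, liftAt_append] at h ⊢
      exact hparent t k h
    · rw [liftAt_of_not_prefix hu]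
      by_cases huk : v <+: u ++ [k]
      · exact T.parent_mem u k (below hu huk ▸ hv)
      · exact T.parent_mem u k (by rwa [liftAt_of_not_prefix huk] at h)
  · by_cases hu : v <+: u
    · obtain ⟨t, rfl⟩ := hu
      simp only [List.append_assoc, liftAt_append] at h ⊢
      exact hleft t k h
    · by_cases huk : v <+: u ++ [k]
      · simpa [← below hu huk, liftAt] using hroot
      · rw [liftAt_of_not_prefix huk]
        by_cases huk' : v <+: u ++ [k + 1]
        · exact T.left_mem u k (below hu huk' ▸ hv)
        · exact T.left_mem u k (by rwa [liftAt_of_not_prefix huk'] at h)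

namespace IsComap

/-- The map on nodes induced by the renaming. -/
def node (hc : IsComap σ T' T h) (u : T'.Node) : T.Node := ⟨h u.1, (hc.mem_iff u.1).1 u.2⟩

theorem card_lt (hc : IsComap σ T' T h) {z : List ℕ} (hz : z ∈ T.dom) (hzh : z ∉ Set.range h) :
    T'.dom.card < T.dom.card := by
  classical
  rw [← Finset.card_image_of_injective T'.dom hc.injective]
  refine Finset.card_lt_card ⟨fun x hx => ?_, fun hsub => ?_⟩
  · obtain ⟨u, hu, rfl⟩ := Finset.mem_image.1 hx
    exact (hc.mem_iff u).1 hu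
  · obtain ⟨u, -, hu⟩ := Finset.mem_image.1 (hsub hz)
    exact hzh ⟨u, hu⟩

theorem update (hc : IsComap σ T' T g) {y : List ℕ} {x w : T.Node} (hy : g y = x.1)
    (hw : w.1 ∉ Set.range g) (htype : T.oneType σ w = T.oneType σ x) :
    IsComap σ T' T (Function.update g y w.1) := by
  have hmem : ∀ u, u ∈ T'.dom ↔ Function.update g y w.1 u ∈ T.dom := fun u => by
    by_cases hu : u = y
    · subst hu
      simp only [Function.update_self, w.2, hc.mem_iff, hy, x.2]
    · rw [Function.update_of_ne hu, hc.mem_iff]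
  refine ⟨injective_update hc.injective hw, hmem, fun u => ?_⟩
  rw [hc.oneType_eq]
  by_cases hu : u.1 = y
  · simp only [hu, hy, Function.update_self]
    exact htype.symm
  · simp only [Function.update_of_ne hu]

variable (hc : IsComap σ T' T h) {u : T'.Node}
include hc

theorem agree {u' : T'.Node} (hrel : SameRel u.1 u'.1 (h u.1) (h u'.1)) :
    Agree σ T' u u' T (hc.node u) (hc.node u') :=
  .of_oneType_eq (hc.oneType_eq u) (hc.oneType_eq u') hrel

theorem ncard_witnesses {P : Set (List ℕ)}
    (hrel : ∀ u' ∈ P, SameRel u.1 u' (h u.1) (h u')) {χ : Formula U} (hq : χ.IsQuantifierFree)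
    (hχ : χ.symbols ⊆ σ) :
    {u' : T'.Node | u'.1 ∈ P ∧ χ.Holds T' u u'}.ncard =
      {z : T.Node | z.1 ∈ h '' P ∧ χ.Holds T (hc.node u) z}.ncard := by
  have hnode : hc.node.Injective := fun _ _ huv =>
    Subtype.ext (hc.injective (congrArg Subtype.val huv))
  have hholds : ∀ u' : T'.Node, u'.1 ∈ P →
      (χ.Holds T' u u' ↔ χ.Holds T (hc.node u) (hc.node u')) := fun u' hu' =>
    (hc.agree (hrel u'.1 hu')).holds_iff hq hχ
  rw [← Set.ncard_image_of_injective _ hnode]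
  congr 1
  ext z
  constructor
  · rintro ⟨u', ⟨hP, hu'⟩, rfl⟩
    exact ⟨⟨u'.1, hP, rfl⟩, (hholds u' hP).1 hu'⟩
  · rintro ⟨⟨u', hP, hz⟩, hχz⟩
    have hu' : u' ∈ T'.dom := (hc.mem_iff u').2 (hz ▸ z.2)
    obtain rfl : hc.node ⟨u', hu'⟩ = z := Subtype.ext hz
    exact ⟨⟨u', hu'⟩, ⟨hP, (hholds ⟨u', hu'⟩ hP).2 hχz⟩, rfl⟩

end IsComap

variable (σ) in
/-- The nodes with an address in `R` that have the type of `z` and that `a` sees in the same way as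
`z`. -/
def copies (T : TreeStructure U) (R : Set (List ℕ)) (a : List ℕ) (z : T.Node) : Set T.Node :=
  {x | x.1 ∈ R ∧ T.oneType σ x = T.oneType σ z ∧ SameRel a x.1 a z.1}

variable {k : ℕ}

theorem SameCounts.le_ncard_copies {S S' R : Set (List ℕ)} (h : T.SameCounts σ k S S')
    (hS : S ⊆ S') (hR : S ⊆ R) {a : List ℕ} {z : T.Node} (hz : z.1 ∈ S') (hzR : z.1 ∉ R)
    (hrel : ∀ x ∈ S, SameRel a x a z.1) : k ≤ (T.copies σ R a z).ncard :=
  (h.le_count hS hz fun hzS => hzR (hR hzS)).trans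
    (Set.ncard_le_ncard (fun x hx => ⟨hR hx.1, hx.2, hrel x.1 hx.1⟩) (Set.toFinite _))

variable (σ k) in
/-- From the node `u` of `T'`, the tree `T` seen along the renaming `h` looks like `T'`: the nodes
in the range of `h` stand in the same relations, and each lost node of `T` has `k` copies that are
not lost. -/
structure IsViewFrom (T' T : TreeStructure U) (h : List ℕ → List ℕ) (u : List ℕ) : Prop
    extends IsComap σ T' T h where
  sameRel : ∀ u', SameRel u u' (h u) (h u')
  copies : ∀ z : T.Node, z.1 ∉ Set.range h → k ≤ (T.copies σ (Set.range h) (h u) z).ncard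

theorem IsViewFrom.min_ncard_witnesses {u : T'.Node} (hv : IsViewFrom σ k T' T h u.1)
    {χ : Formula U} (hq : χ.IsQuantifierFree) (hχ : χ.symbols ⊆ σ) :
    min k {u' | χ.Holds T' u u'}.ncard = min k {z | χ.Holds T (hv.node u) z}.ncard := by
  have hncard := hv.ncard_witnesses (P := Set.univ) (fun u' _ => hv.sameRel u') hq hχ
  simp only [Set.mem_univ, true_and, Set.image_univ] at hncard
  rw [hncard]
  by_cases hlost : ∃ z, χ.Holds T (hv.node u) z ∧ z.1 ∉ Set.range h
  · obtain ⟨z, hχz, hz⟩ := hlost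
    have hsub : T.copies σ (Set.range h) (h u.1) z ⊆
        {x | x.1 ∈ Set.range h ∧ χ.Holds T (hv.node u) x} := fun x hx =>
      ⟨hx.1, ((Agree.of_oneType_eq rfl hx.2.1 hx.2.2).holds_iff hq hχ).2 hχz⟩
    have hcopies := (hv.copies z hz).trans (Set.ncard_le_ncard hsub (Set.toFinite _))
    have hle : {x | x.1 ∈ Set.range h ∧ χ.Holds T (hv.node u) x}.ncard ≤
        {x | χ.Holds T (hv.node u) x}.ncard :=
      Set.ncard_le_ncard (fun _ hx => hx.2) (Set.toFinite _)
    rw [min_eq_left hcopies, min_eq_left (hcopies.trans hle)]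
  · push Not at hlost
    congr 2
    ext z
    exact and_iff_right_of_imp (hlost z)

theorem IsViewFrom.sameWitnessCounts {φ : NormalForm U} {u : T'.Node}
    (hv : IsViewFrom φ.toFormula.symbols (φ.C + 1) T' T h u.1) :
    φ.SameWitnessCounts T' u T (hv.node u) := fun i =>
  hv.min_ncard_witnesses (φ.chiC_qf i) (φ.symbols_chiC_subset i)

end TreeStructure

/-! ### Pigeonhole -/

/-- Along monotone functions two indices have equal values as soon as the sums agree; this is why
the number of values enters only linearly. -/
theorem exists_lt_map_eq_of_monotone {κ ι : Type*} [Finite κ] [Finite ι] {n B : ℕ}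
    (key : Fin n → κ) (q : ι → Fin n → ℕ) (hq : ∀ i, Monotone (q i)) (hB : ∀ i j, q i j ≤ B)
    (hn : Nat.card κ * (Nat.card ι * B + 1) < n) :
    ∃ a b, a < b ∧ key a = key b ∧ ∀ i, q i a = q i b := by
  have := Fintype.ofFinite κ
  have := Fintype.ofFinite ι
  rw [Nat.card_eq_fintype_card, Nat.card_eq_fintype_card] at hn
  have hsum : ∀ j, ∑ i, q i j < Fintype.card ι * B + 1 := fun j =>
    Nat.lt_succ_of_le ((Finset.sum_le_sum fun i _ => hB i j).trans (by simp))
  obtain ⟨a, b, hab, h⟩ := Fintype.exists_ne_map_eq_of_card_lt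
    (fun j => ((key j, ⟨∑ i, q i j, hsum j⟩) : κ × Fin (Fintype.card ι * B + 1)))
    (by simpa using hn)
  wlog hlt : a < b generalizing a b
  · exact this b a hab.symm h.symm (lt_of_le_of_ne (not_lt.1 hlt) hab.symm)
  simp only [Prod.mk.injEq, Fin.mk.injEq] at h
  exact ⟨a, b, hlt, h.1, fun i =>
    (Finset.sum_eq_sum_iff_of_le fun i _ => hq i hlt.le).1 h.2 i (Finset.mem_univ i)⟩

theorem TreeStructure.exists_lt_sameCounts {U : Type*} {σ : Set (U ⊕ Nav)} [Finite (oneTypes σ)]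
    (T : TreeStructure U) {κ ι : Type*} [Finite κ] [Finite ι] {n k : ℕ} (key : Fin n → κ)
    (S : ι → Fin n → Set (List ℕ)) (hS : ∀ i, Monotone (S i) ∨ Antitone (S i))
    (hn : Nat.card κ * (Nat.card ι * Nat.card (oneTypes σ) * k + 1) < n) :
    ∃ a b, a < b ∧ key a = key b ∧ ∀ i, T.SameCounts σ k (S i a) (S i b) := by
  have hmono : ∀ p : ι × oneTypes σ, ∃ q : Fin n → ℕ, Monotone q ∧ (∀ j, q j ≤ k) ∧
      ∀ a b, q a = q b → min k (T.count σ (S p.1 a) p.2) = min k (T.count σ (S p.1 b) p.2) := by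
    rintro ⟨i, α⟩
    rcases hS i with hi | hi
    · exact ⟨fun j => min k (T.count σ (S i j) α), fun a b hab =>
        min_le_min_left k (TreeStructure.count_mono (hi hab) α), fun j => min_le_left _ _,
        fun a b => id⟩
    · refine ⟨fun j => k - min k (T.count σ (S i j) α), fun a b hab => Nat.sub_le_sub_left
        (min_le_min_left k (TreeStructure.count_mono (hi hab) α)) k, fun j => Nat.sub_le _ _,
        fun a b hab => ?_⟩
      simp only at hab ⊢
      omega
  choose q hq hqk hqeq using hmono
  obtain ⟨a, b, hab, hkey, h⟩ :=
    exists_lt_map_eq_of_monotone key q hq hqk (by rwa [Nat.card_prod])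
  exact ⟨a, b, hab, hkey, fun i α => hqeq (i, α) a b (h (i, α))⟩

/-! ### Shortening a path -/

/-- The renaming that replaces the subtree at `v` by the subtree at its descendant `v ++ s`. -/
def contract (v s : List ℕ) : List ℕ → List ℕ := liftAt v (s ++ ·)

section Contract

variable {v s t u : List ℕ}

@[simp] theorem contract_append : contract v s (v ++ t) = v ++ (s ++ t) := liftAt_append t

@[simp] theorem contract_self : contract v s v = v ++ s := by
  simpa using contract_append (v := v) (s := s) (t := [])

theorem contract_of_not_prefix (h : ¬ v <+: u) : contract v s u = u := liftAt_of_not_prefix h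

theorem mem_range_contract_iff : u ∈ Set.range (contract v s) ↔ (v <+: u → v ++ s <+: u) := by
  constructor
  · rintro ⟨x, rfl⟩ hx
    obtain ⟨t, rfl⟩ := prefix_liftAt_iff.1 hx
    simp
  · intro h
    by_cases hu : v <+: u
    · obtain ⟨t, rfl⟩ := h hu
      exact ⟨v ++ t, by simp⟩
    · exact mem_range_liftAt_of_not_prefix hu

theorem notMem_range_contract (hs : s ≠ []) : v ∉ Set.range (contract v s) := fun h =>
  hs (by simpa using (mem_range_contract_iff.1 h List.prefix_rfl).length_le)

theorem sameRel_contract (t : List ℕ) :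
    SameRel v (v ++ t) (contract v s v) (contract v s (v ++ t)) := by
  simpa using SameRel.append_left v (SameRel.append_append s [] t).symm

theorem sameRel_update_contract (hu : ¬ v <+: u) :
    SameRel v u (Function.update (contract v s) v v v)
      (Function.update (contract v s) v v u) := by
  rw [Function.update_self, Function.update_of_ne (by rintro rfl; simp at hu),
    contract_of_not_prefix hu]
  exact .refl _ _

theorem image_contract : contract v s '' {x | v <+: x} = {x | v ++ s <+: x} := by
  ext x
  constructor
  · rintro ⟨_, ⟨t, rfl⟩, rfl⟩
    exact ⟨t, by simp⟩
  · rintro ⟨t, rfl⟩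
    exact ⟨v ++ t, ⟨t, rfl⟩, by simp⟩

theorem image_update_contract :
    Function.update (contract v s) v v '' {x | ¬ v <+: x} = {x | ¬ v <+: x} := by
  refine (Set.image_congr fun x hx => ?_).trans (Set.image_id _)
  rw [Function.update_of_ne (by rintro rfl; simp at hx), contract_of_not_prefix hx, id]

theorem TreeStructure.exists_isComap_contract {U : Type*} {σ : Set (U ⊕ Nav)}
    (T : TreeStructure U) (hvs : v ++ s ∈ T.dom) :
    ∃ T' : TreeStructure U, IsComap σ T' T (contract v s) := by
  refine T.exists_isComap_liftAt (List.append_right_injective s) (by simpa using hvs)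
    (fun t k h => ?_) (fun t k h => ?_)
  · exact T.parent_mem _ k (by simpa using h)
  · simpa using T.left_mem (v ++ (s ++ t)) k (by simpa using h)

end Contract

theorem ncard_setOf_eq_add {α : Type*} [Finite α] (p q : α → Prop) :
    {x | q x}.ncard = {x | p x ∧ q x}.ncard + {x | ¬ p x ∧ q x}.ncard := by
  rw [← Set.ncard_inter_add_ncard_sdiff_eq_ncard {x | q x} {x | p x}]
  congr 2 <;> ext x <;> exact and_comm

section Path

open TreeStructure

variable {U : Type*} {φ : NormalForm U} {T T' : TreeStructure U} {v w : T.Node} {s : List ℕ}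

/-- The witnesses of `v` for the `i`-th counting conjunct that are not below `v`. -/
def NormalForm.outerWitnesses (φ : NormalForm U) (i : Fin φ.m) (v : T.Node) : Set T.Node :=
  {z | ¬ v.1 <+: z.1 ∧ (φ.chiC i).Holds T v z}

variable (φ) in
/-- The nodes `v` and `w` of a path look alike up to the threshold `C(φ) + 1`, in a way that allows
to replace the subtree at the upper one by the subtree at the lower one. -/
structure PathAlike (T : TreeStructure U) (v w : T.Node) : Prop where
  oneType_eq : T.oneType φ.toFormula.symbols v = T.oneType φ.toFormula.symbols w
  outerWitnesses_eq : ∀ i, min (φ.C + 1) (φ.outerWitnesses i v).ncard =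
    min (φ.C + 1) (φ.outerWitnesses i w).ncard
  descendants : T.SameCounts φ.toFormula.symbols (φ.C + 1)
    (strictDescendants v.1) (strictDescendants w.1)
  ancestors : T.SameCounts φ.toFormula.symbols (φ.C + 1)
    (strictAncestors v.1) (strictAncestors w.1)
  incomparables : T.SameCounts φ.toFormula.symbols (φ.C + 1)
    (incomparables v.1) (incomparables w.1)

namespace PathAlike

variable (halike : PathAlike φ T v w) (hw : w.1 = v.1 ++ s)
  (hc : IsComap φ.toFormula.symbols T' T (contract v.1 s))

include halike hw hc

theorem isComap_update (hs : s ≠ []) :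
    IsComap φ.toFormula.symbols T' T (Function.update (contract v.1 s) v.1 v.1) :=
  hc.update (x := w) (by rw [contract_self, hw]) (notMem_range_contract hs) halike.oneType_eq

/-- A node that is not below `v` sees the strict descendants of `v` in the same way, so those of `w`
replace them; the node `v` itself can be kept, as its subtree loses nothing but copies. -/
theorem isViewFrom_of_not_prefix (hs : s ≠ []) {u : List ℕ} (hu : ¬ v.1 <+: u) :
    IsViewFrom φ.toFormula.symbols (φ.C + 1) T' T
      (Function.update (contract v.1 s) v.1 v.1) u := by
  have hself : Function.update (contract v.1 s) v.1 v.1 u = u := by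
    rw [Function.update_of_ne (by rintro rfl; simp at hu), contract_of_not_prefix hu]
  refine ⟨halike.isComap_update hw hc hs, fun u' => ?_, fun z hz => ?_⟩
  · rw [hself]
    by_cases hu' : v.1 <+: u'
    · obtain ⟨t, rfl⟩ := hu'
      rcases eq_or_ne t [] with rfl | ht
      · simpa using SameRel.refl _ _
      · rw [Function.update_of_ne (by simpa using ht), contract_append]
        exact .of_not_prefix hu ht (by simp [hs])
    · rw [Function.update_of_ne (by rintro rfl; simp at hu'), contract_of_not_prefix hu']
      exact .refl _ _
  · have hz' := hz
    rw [mem_range_update_iff hc.injective, mem_range_contract_iff, contract_self, ← hw] at hz'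
    push Not at hz'
    have hvz : v.1 <+: z.1 := by
      by_contra hvz
      exact hvz ((hz'.2 fun h => (hvz h).elim) ▸ ⟨s, hw.symm⟩)
    rw [hself]
    refine halike.descendants.symm.le_ncard_copies (strictDescendants_anti ⟨s, hw.symm⟩) ?_
      ⟨hvz, hz'.1⟩ hz ?_
    · rintro x ⟨hx, hxw⟩
      rw [mem_range_update_iff hc.injective, mem_range_contract_iff, contract_self, ← hw]
      exact Or.inr ⟨fun _ => hx, hxw⟩
    · rintro x ⟨⟨t, rfl⟩, _⟩
      obtain ⟨r, hr⟩ := hvz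
      rw [hw, List.append_assoc, ← hr]
      exact .of_not_prefix hu (by simp [hs]) (by rintro rfl; exact hz'.1 (by simpa using hr.symm))

/-- A strict descendant of `w` sees the nodes that are not below `w` in only two ways: as ancestors
other than its parent, or as incomparable nodes that are not its siblings. -/
theorem isViewFrom_append {t : List ℕ} (ht : t ≠ []) :
    IsViewFrom φ.toFormula.symbols (φ.C + 1) T' T (contract v.1 s) (v.1 ++ t) := by
  have hvw : v.1 <+: w.1 := ⟨s, hw.symm⟩
  have hsub : ∀ x, ¬ v.1 <+: x → x ∈ Set.range (contract v.1 s) := fun x hx =>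
    mem_range_liftAt_of_not_prefix hx
  refine ⟨hc, fun u' => ?_, fun z hz => ?_⟩
  · rw [contract_append]
    by_cases hu' : v.1 <+: u'
    · obtain ⟨t', rfl⟩ := hu'
      rw [contract_append]
      exact .append_left v.1 (SameRel.append_append s t t').symm
    · rw [contract_of_not_prefix hu']
      by_cases hu'v : u' <+: v.1
      · have hmem : u' ∈ strictAncestors v.1 := ⟨hu'v, by rintro rfl; simp at hu'⟩
        exact (SameRel.of_mem_strictAncestors hmem ht).trans
          (SameRel.of_mem_strictAncestors hmem (by simp [ht])).symm
      · exact (SameRel.of_mem_incomparables ⟨hu', hu'v⟩ ht).trans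
          (SameRel.of_mem_incomparables ⟨hu', hu'v⟩ (by simp [ht])).symm
  · have hz' := hz
    rw [mem_range_contract_iff, ← hw, Classical.not_imp] at hz'
    rw [contract_append, ← List.append_assoc, ← hw]
    by_cases hzw : z.1 <+: w.1
    · have hmem : z.1 ∈ strictAncestors w.1 := ⟨hzw, fun h => hz'.2 (h ▸ List.prefix_rfl)⟩
      refine halike.ancestors.le_ncard_copies (strictAncestors_mono hvw) (fun x hx => ?_) hmem hz
        fun x hx => ?_
      · exact hsub x fun h => hx.2 (hx.1.eq_of_length_le h.length_le)
      · exact (SameRel.of_mem_strictAncestors (strictAncestors_mono hvw hx) ht).trans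
          (SameRel.of_mem_strictAncestors hmem ht).symm
    · have hmem : z.1 ∈ _root_.incomparables w.1 := ⟨hz'.2, hzw⟩
      refine halike.incomparables.le_ncard_copies (incomparables_mono hvw) (fun x hx => ?_) hmem hz
        fun x hx => ?_
      · exact hsub x hx.1
      · exact (SameRel.of_mem_incomparables (incomparables_mono hvw hx) ht).trans
          (SameRel.of_mem_incomparables hmem ht).symm

/-- The witnesses of the new node at `v` below it are those of `w`, the other ones are those of
`v`. -/
theorem sameWitnessCounts (hs : s ≠ []) {u : T'.Node} (hu : u.1 = v.1) :
    φ.SameWitnessCounts T' u T w := by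
  intro i
  have hc' := halike.isComap_update hw hc hs
  have hin := hc.ncard_witnesses (u := u) (P := {x | v.1 <+: x})
    (by rintro _ ⟨t, rfl⟩; rw [hu]; exact sameRel_contract t)
    (φ.chiC_qf i) (φ.symbols_chiC_subset i)
  have hout := hc'.ncard_witnesses (u := u) (P := {x | ¬ v.1 <+: x})
    (by rintro u' hu'; rw [hu]; exact sameRel_update_contract hu')
    (φ.chiC_qf i) (φ.symbols_chiC_subset i)
  have hnode : hc.node u = w := Subtype.ext (by simp [IsComap.node, hu, hw])
  have hnode' : hc'.node u = v := Subtype.ext (by simp [IsComap.node, hu])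
  simp only [image_contract, image_update_contract, ← hw, hnode, hnode', Set.mem_ofPred_eq]
    at hin hout
  rw [ncard_setOf_eq_add (fun u' : T'.Node => v.1 <+: u'.1) ((φ.chiC i).Holds T' u),
    ncard_setOf_eq_add (fun z : T.Node => w.1 <+: z.1) ((φ.chiC i).Holds T w), hin, hout]
  have := halike.outerWitnesses_eq i
  simp only [NormalForm.outerWitnesses] at this
  omega

omit hw hc in
theorem exists_model_card_lt (hT : T.Models φ.toFormula)
    (hvw : v.1 <+: w.1) (hne : v.1 ≠ w.1) :
    ∃ T' : TreeStructure U, T'.Models φ.toFormula ∧ T'.dom.card < T.dom.card := by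
  obtain ⟨s, hw⟩ := hvw
  replace hw := hw.symm
  have hs : s ≠ [] := by rintro rfl; exact hne (by simpa using hw.symm)
  obtain ⟨T', hc⟩ := T.exists_isComap_contract (σ := φ.toFormula.symbols) (hw ▸ w.2)
  have hc' := halike.isComap_update hw hc hs
  have hout : ∀ {u : T'.Node}, ¬ v.1 <+: u.1 → IsViewFrom _ _ T' T _ u.1 :=
    halike.isViewFrom_of_not_prefix hw hc hs
  have hview : ∀ {u : T'.Node}, u.1 ≠ v.1 →
      ∃ h, IsViewFrom φ.toFormula.symbols (φ.C + 1) T' T h u.1 := by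
    intro u hu
    by_cases hvu : v.1 <+: u.1
    · obtain ⟨t, ht⟩ := hvu
      have := halike.isViewFrom_append hw hc (t := t) (by rintro rfl; simp [← ht] at hu)
      exact ⟨_, ht ▸ this⟩
    · exact ⟨_, hout hvu⟩
  refine ⟨T', NormalForm.models_of_agree hT (fun u u' => ?_) fun u => ?_,
    hc.card_lt v.2 (notMem_range_contract hs)⟩
  · by_cases hu : u.1 = v.1
    · by_cases hu' : v.1 <+: u'.1
      · obtain ⟨t, ht⟩ := hu'
        exact ⟨_, _, hc.agree (by rw [hu, ← ht]; exact sameRel_contract t)⟩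
      · exact ⟨_, _, hc'.agree (by rw [hu]; exact sameRel_update_contract hu')⟩
    · obtain ⟨h, hv⟩ := hview hu
      exact ⟨_, _, hv.agree (hv.sameRel u'.1)⟩
  · by_cases hu : u.1 = v.1
    · exact ⟨w, halike.sameWitnessCounts hw hc hs hu⟩
    · obtain ⟨h, hv⟩ := hview hu
      exact ⟨_, hv.sameWitnessCounts⟩

end PathAlike

theorem TreeFrame.IsDownPath.mem_strictAncestors {T : TreeFrame} {P : List T.Node}
    (hP : T.IsDownPath P) {a b : Fin P.length} (hab : a < b) :
    P[a].1 ∈ strictAncestors P[b].1 := by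
  have hchain : P.IsChain (Relation.TransGen T.Child) := hP.imp fun _ _ => .single
  exact (T.transGen_child_iff _ _).1
    (List.pairwise_iff_getElem.1 (List.isChain_iff_pairwise.1 hchain) a b a.2 b.2 hab)

theorem length_le_of_minimalFor
    (hT : MinimalFor (fun T : TreeStructure U => T.Models φ.toFormula) (fun T => T.dom.card) T)
    {P : List T.Node} (hP : T.IsDownPath P) :
    P.length ≤ φ.numOneTypes * (φ.C + 2) ^ φ.m * (3 * φ.numOneTypes * (φ.C + 1) + 1) := by
  by_contra! hlong
  let key (j : Fin P.length) : oneTypes φ.toFormula.symbols × (Fin φ.m → Fin (φ.C + 2)) :=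
    (T.oneType _ P[j], fun i =>
      ⟨min (φ.C + 1) (φ.outerWitnesses i P[j]).ncard, Nat.lt_succ_of_le (min_le_left _ _)⟩)
  have hprefix {a b : Fin P.length} (hab : a ≤ b) : P[a].1 <+: P[b].1 := by
    rcases hab.eq_or_lt with rfl | hlt
    · exact List.prefix_rfl
    · exact (hP.mem_strictAncestors hlt).1
  obtain ⟨a, b, hab, hkey, hcounts⟩ := T.exists_lt_sameCounts (σ := φ.toFormula.symbols)
    (k := φ.C + 1) key
    ![fun j => strictDescendants P[j].1, fun j => strictAncestors P[j].1,
      fun j => incomparables P[j].1]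
    (by
      simp only [Fin.forall_fin_succ, Matrix.cons_val_zero, Matrix.cons_val_succ]
      exact ⟨Or.inr fun _ _ h => strictDescendants_anti (hprefix h),
        Or.inl fun _ _ h => strictAncestors_mono (hprefix h),
        Or.inl fun _ _ h => incomparables_mono (hprefix h), fun i => i.elim0⟩)
    (by simpa [φ.numOneTypes_eq_card] using hlong)
  simp only [key, Prod.mk.injEq, funext_iff, Fin.mk.injEq] at hkey
  have halike : PathAlike φ T P[a] P[b] := ⟨hkey.1, hkey.2, hcounts 0, hcounts 1, hcounts 2⟩
  obtain ⟨hpre, hne⟩ := hP.mem_strictAncestors hab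
  obtain ⟨T', hT', hlt⟩ := halike.exists_model_card_lt hT.prop hpre hne
  exact hT.not_lt hT' hlt

end Path
/-! ### Removing children -/

/-- Increase the first index of an address by `d` if it is larger than `a`. -/
def shiftFrom (a d : ℕ) : List ℕ → List ℕ
  | [] => []
  | j :: t => (if a < j then j + d else j) :: t

theorem shiftFrom_injective (a d : ℕ) : (shiftFrom a d).Injective := by
  rintro (_ | ⟨i, s⟩) (_ | ⟨j, t⟩) h
  · rfl
  · simp [shiftFrom] at h
  · simp [shiftFrom] at h
  · simp only [shiftFrom, List.cons.injEq] at h ⊢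
    refine ⟨?_, h.2⟩
    have := h.1
    split_ifs at this <;> omega

/-- The renaming that drops the subtrees of the children of `p` with indices from `a + 1` to
`a + d` and closes the gap. -/
def cutChildren (p : List ℕ) (a d : ℕ) : List ℕ → List ℕ := liftAt p (shiftFrom a d)

section CutChildren

variable {p u z t : List ℕ} {a d j : ℕ}

theorem cutChildren_of_le (h : j ≤ a) : cutChildren p a d (p ++ j :: t) = p ++ j :: t := by
  simp [cutChildren, shiftFrom, h.not_gt]

theorem cutChildren_of_lt (h : a < j) : cutChildren p a d (p ++ j :: t) = p ++ (j + d) :: t := by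
  simp [cutChildren, shiftFrom, h]

theorem cutChildren_succ : cutChildren p a d (p ++ [a + 1]) = p ++ [a + d + 1] := by
  rw [cutChildren_of_lt (Nat.lt_succ_self a), Nat.add_right_comm]

theorem cutChildren_eq_self (hu : ∀ j t, u = p ++ j :: t → j ≤ a) : cutChildren p a d u = u := by
  by_cases hp : p <+: u
  · obtain ⟨_ | ⟨j, t⟩, rfl⟩ := hp
    · simp [cutChildren, liftAt, shiftFrom]
    · exact cutChildren_of_le (hu j t rfl)
  · exact liftAt_of_not_prefix hp

theorem cutChildren_injective : (cutChildren p a d).Injective :=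
  liftAt_injective (shiftFrom_injective a d)

theorem mem_range_cutChildren_iff :
    z ∈ Set.range (cutChildren p a d) ↔ ∀ j t, z = p ++ j :: t → j ≤ a ∨ a + d < j := by
  constructor
  · rintro ⟨x, rfl⟩ j t hx
    obtain ⟨_ | ⟨i, s⟩, rfl⟩ := prefix_liftAt_iff.1 ⟨_, hx.symm⟩
    · simp [cutChildren_eq_self] at hx
    · simp only [cutChildren, liftAt_append, shiftFrom, List.append_cancel_left_eq,
        List.cons.injEq] at hx
      split_ifs at hx <;> omega
  · intro h
    by_cases hz : ∃ j t, z = p ++ j :: t ∧ a < j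
    · obtain ⟨j, t, rfl, hj⟩ := hz
      have hj' := h j t rfl
      exact ⟨p ++ (j - d) :: t, by
        rw [cutChildren_of_lt (by omega), Nat.sub_add_cancel (by omega)]⟩
    · push Not at hz
      exact ⟨z, cutChildren_eq_self hz⟩

theorem notMem_range_cutChildren (haj : a < j) (hjd : j ≤ a + d) :
    p ++ j :: t ∉ Set.range (cutChildren p a d) := by
  rw [mem_range_cutChildren_iff]
  intro h
  have := h j t rfl
  omega

theorem mem_range_update_cutChildren_iff {i i' b : ℕ}
    (hi : cutChildren p a d (p ++ [i]) = p ++ [i']) :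
    z ∈ Set.range (Function.update (cutChildren p a d) (p ++ [i]) (p ++ [b])) ↔
      ∀ j t, z = p ++ j :: t → (t ≠ [] → j ≤ a ∨ a + d < j) ∧
        (t = [] → j = b ∨ (j ≤ a ∨ a + d < j) ∧ j ≠ i') := by
  rw [mem_range_update_iff cutChildren_injective, mem_range_cutChildren_iff, hi]
  constructor
  · rintro (h | ⟨hz, hne⟩) j t hzj
    · obtain ⟨rfl, rfl⟩ : b = j ∧ [] = t := by simpa using h.symm.trans hzj
      simp
    · refine ⟨fun _ => hz j t hzj, fun ht => Or.inr ⟨hz j t hzj, ?_⟩⟩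
      rintro rfl
      exact hne (by rw [hzj, ht])
  · intro h
    by_cases hb : z = p ++ [b]
    · exact Or.inl hb
    · refine Or.inr ⟨fun j t hz => ?_, fun hz => ?_⟩
      · by_cases ht : t = []
        · exact (((h j t hz).2 ht).resolve_left fun hj => hb (by rw [hz, ht, hj])).1
        · exact (h j t hz).1 ht
      · rcases (h i' [] hz).2 rfl with hi' | hi'
        · exact hb (hi' ▸ hz)
        · exact hi'.2 rfl

theorem TreeStructure.exists_isComap_cutChildren {U : Type*} {σ : Set (U ⊕ Nav)}
    (T : TreeStructure U) (hp : p ∈ T.dom) (a d : ℕ) :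
    ∃ T' : TreeStructure U, IsComap σ T' T (cutChildren p a d) := by
  refine T.exists_isComap_liftAt (shiftFrom_injective a d) (by simpa [shiftFrom] using hp)
    (fun t k h => ?_) (fun t k h => ?_)
  · cases t with
    | nil => simpa [shiftFrom] using hp
    | cons j t => exact T.parent_mem _ k (by simpa [shiftFrom] using h)
  · cases t with
    | nil =>
      refine T.sibling_mem_of_le ?_ h
      split_ifs <;> omega
    | cons j t =>
      simpa [shiftFrom] using
        T.left_mem (p ++ shiftFrom a d (j :: t)) k (by simpa [shiftFrom] using h)

end CutChildren

section Cut

open TreeStructure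

/-- The children of `p` to the left of the child with index `j`. -/
def leftOf (p : List ℕ) (j : ℕ) : Set (List ℕ) := {z | ∃ l < j, z = p ++ [l]}

/-- The children of `p` to the right of the right sibling of the child with index `j`. -/
def rightOf (p : List ℕ) (j : ℕ) : Set (List ℕ) := {z | ∃ l, j + 1 < l ∧ z = p ++ [l]}

/-- The strict descendants of the children of `p` up to index `j`. -/
def belowLeft (p : List ℕ) (j : ℕ) : Set (List ℕ) := {z | ∃ l ≤ j, ∃ t ≠ [], z = p ++ l :: t}

/-- The strict descendants of the children of `p` with an index larger than `j`. -/
def belowRight (p : List ℕ) (j : ℕ) : Set (List ℕ) := {z | ∃ l, j < l ∧ ∃ t ≠ [], z = p ++ l :: t}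

theorem leftOf_mono (p : List ℕ) : Monotone (leftOf p) :=
  fun _ _ h _ ⟨l, hl, hz⟩ => ⟨l, hl.trans_le h, hz⟩

theorem rightOf_anti (p : List ℕ) : Antitone (rightOf p) :=
  fun _ _ h _ ⟨l, hl, hz⟩ => ⟨l, by omega, hz⟩

theorem belowLeft_mono (p : List ℕ) : Monotone (belowLeft p) :=
  fun _ _ h _ ⟨l, hl, hz⟩ => ⟨l, hl.trans h, hz⟩

theorem belowRight_anti (p : List ℕ) : Antitone (belowRight p) :=
  fun _ _ h _ ⟨l, hl, hz⟩ => ⟨l, h.trans_lt hl, hz⟩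

variable {U : Type*} {φ : NormalForm U} {T T' : TreeStructure U} {p : List ℕ} {a d : ℕ}

variable (φ) in
/-- The cuts after the children of `p` with the indices `a` and `a + d` look alike up to the
threshold `C(φ) + 1`, in a way that allows to remove what lies between them. -/
structure CutAlike (T : TreeStructure U) (p : List ℕ) (a d : ℕ) : Prop where
  mem {j : ℕ} : j ≤ a + d + 1 → p ++ [j] ∈ T.dom
  oneType_eq : T.oneType φ.toFormula.symbols ⟨p ++ [a], mem (by omega)⟩ =
    T.oneType φ.toFormula.symbols ⟨p ++ [a + d], mem (by omega)⟩
  oneType_succ_eq : T.oneType φ.toFormula.symbols ⟨p ++ [a + 1], mem (by omega)⟩ =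
    T.oneType φ.toFormula.symbols ⟨p ++ [a + d + 1], mem le_rfl⟩
  leftOf : T.SameCounts φ.toFormula.symbols (φ.C + 1) (leftOf p a) (leftOf p (a + d))
  rightOf : T.SameCounts φ.toFormula.symbols (φ.C + 1) (rightOf p a) (rightOf p (a + d))
  belowLeft : T.SameCounts φ.toFormula.symbols (φ.C + 1) (belowLeft p a) (belowLeft p (a + d))
  belowRight : T.SameCounts φ.toFormula.symbols (φ.C + 1) (belowRight p a) (belowRight p (a + d))

theorem sameRel_update_cutChildren_succ {u : List ℕ} (hu : ∀ i s, u = p ++ i :: s → i ≤ a)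
    (u' : List ℕ) : SameRel u u' u
      (Function.update (cutChildren p a d) (p ++ [a + 1]) (p ++ [a + 1]) u') := by
  by_cases hkept : u' = p ++ [a + 1]
  · rw [hkept, Function.update_self]
    exact .refl _ _
  rw [Function.update_of_ne hkept]
  by_cases hu' : ∃ j t, u' = p ++ j :: t ∧ a < j
  · obtain ⟨j, t, rfl, hj⟩ := hu'
    rw [cutChildren_of_lt hj]
    rcases eq_or_ne t [] with rfl | ht
    · have hj' : j ≠ a + 1 := by rintro rfl; exact hkept rfl
      refine .of_children fun i s hs => ?_
      have := hu i s hs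
      omega
    · refine .of_strict_grandchildren ht ht fun i s hs => ?_
      have := hu i s hs
      omega
  · push Not at hu'
    rw [cutChildren_eq_self hu']
    exact .refl _ _

theorem sameRel_update_cutChildren {i : ℕ} (hi : a < i) (s u' : List ℕ) :
    SameRel (p ++ i :: s) u' (p ++ (i + d) :: s)
      (Function.update (cutChildren p a d) (p ++ [a]) (p ++ [a + d]) u') := by
  have hshift (j : ℕ) (t : List ℕ) :
      SameRel (p ++ i :: s) (p ++ j :: t) (p ++ (i + d) :: s) (p ++ (j + d) :: t) :=
    .append_left p (.cons_add_cons_add i j d s t)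
  by_cases hkept : u' = p ++ [a]
  · rw [hkept, Function.update_self]
    exact hshift a []
  rw [Function.update_of_ne hkept]
  by_cases hu' : ∃ j t, u' = p ++ j :: t ∧ a < j
  · obtain ⟨j, t, rfl, hj⟩ := hu'
    rw [cutChildren_of_lt hj]
    exact hshift j t
  push Not at hu'
  rw [cutChildren_eq_self hu']
  by_cases hp : p <+: u'
  · obtain ⟨_ | ⟨j, t⟩, rfl⟩ := hp
    · simpa using (SameRel.append_left p (.nil_cons i (i + d) (s := s) .rfl)).swap
    have hj : j ≤ a := hu' j t rfl
    refine (hshift j t).trans ?_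
    rcases eq_or_ne t [] with rfl | ht
    · have hj' : j ≠ a := by rintro rfl; exact hkept rfl
      refine .of_children fun l r hl => ?_
      simp only [List.append_cancel_left_eq, List.cons.injEq] at hl
      omega
    · refine .of_strict_grandchildren ht ht fun l r hl => ?_
      simp only [List.append_cancel_left_eq, List.cons.injEq] at hl
      omega
  · exact (SameRel.of_not_prefix hp (by simp) (by simp)).swap

namespace CutAlike

variable (halike : CutAlike φ T p a d)
include halike

/-- A lost node is a child to the right of the first cut, or below such a child; those to the right
of the second cut are kept, and `u` sees them in the same way. -/
theorem le_ncard_copies_left {u : List ℕ} (hu : ∀ i s, u = p ++ i :: s → i ≤ a) {z : T.Node}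
    (hz : z.1 ∉ Set.range
      (Function.update (cutChildren p a d) (p ++ [a + 1]) (p ++ [a + 1]))) :
    φ.C + 1 ≤ (T.copies φ.toFormula.symbols (Set.range
      (Function.update (cutChildren p a d) (p ++ [a + 1]) (p ++ [a + 1]))) u z).ncard := by
  have hmem {z : List ℕ} := mem_range_update_cutChildren_iff (z := z) (b := a + 1)
    (cutChildren_succ (p := p) (a := a) (d := d))
  have hz' := hz
  rw [hmem] at hz'
  push Not at hz'
  obtain ⟨j, t, hzj, hlost⟩ := hz'
  rcases eq_or_ne t [] with rfl | ht
  · simp only [ne_eq, not_true_eq_false, IsEmpty.forall_iff, true_and, forall_const] at hlost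
    refine halike.rightOf.symm.le_ncard_copies (rightOf_anti p (Nat.le_add_right a d)) ?_
      ⟨j, by omega, hzj⟩ hz ?_
    · rintro x ⟨l, hl, rfl⟩
      simp only [hmem, List.append_cancel_left_eq, List.cons.injEq]
      omega
    · rintro x ⟨l, hl, rfl⟩
      rw [hzj]
      refine .of_children fun i s hs => ?_
      have := hu i s hs
      omega
  · simp only [ne_eq, ht, not_false_eq_true, forall_const, false_and, imp_false, not_or, not_le,
      not_lt] at hlost
    refine halike.belowRight.symm.le_ncard_copies (belowRight_anti p (Nat.le_add_right a d)) ?_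
      ⟨j, by omega, t, ht, hzj⟩ hz ?_
    · rintro x ⟨l, hl, r, hr, rfl⟩
      simp only [hmem, List.append_cancel_left_eq, List.cons.injEq]
      rintro _ _ ⟨rfl, rfl⟩
      simp [hr, hl]
    · rintro x ⟨l, hl, r, hr, rfl⟩
      rw [hzj]
      refine .of_strict_grandchildren hr ht fun i s hs => ?_
      have := hu i s hs
      omega

theorem le_ncard_copies_right {i : ℕ} (hi : a < i) (s : List ℕ) {z : T.Node}
    (hz : z.1 ∉ Set.range (Function.update (cutChildren p a d) (p ++ [a]) (p ++ [a + d]))) :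
    φ.C + 1 ≤ (T.copies φ.toFormula.symbols (Set.range
      (Function.update (cutChildren p a d) (p ++ [a]) (p ++ [a + d]))) (p ++ (i + d) :: s)
        z).ncard := by
  have hmem {z : List ℕ} := mem_range_update_cutChildren_iff (z := z) (b := a + d)
    (cutChildren_of_le (p := p) (d := d) (t := []) (le_refl a))
  have hz' := hz
  rw [hmem] at hz'
  push Not at hz'
  obtain ⟨j, t, hzj, hlost⟩ := hz'
  rcases eq_or_ne t [] with rfl | ht
  · simp only [ne_eq, not_true_eq_false, IsEmpty.forall_iff, true_and, forall_const] at hlost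
    refine halike.leftOf.le_ncard_copies (leftOf_mono p (Nat.le_add_right a d)) ?_
      ⟨j, by omega, hzj⟩ hz ?_
    · rintro x ⟨l, hl, rfl⟩
      simp only [hmem, List.append_cancel_left_eq, List.cons.injEq]
      omega
    · rintro x ⟨l, hl, rfl⟩
      rw [hzj]
      refine .of_children fun i' r h => ?_
      simp only [List.append_cancel_left_eq, List.cons.injEq] at h
      omega
  · simp only [ne_eq, ht, not_false_eq_true, forall_const, false_and, imp_false, not_or, not_le,
      not_lt] at hlost
    refine halike.belowLeft.le_ncard_copies (belowLeft_mono p (Nat.le_add_right a d)) ?_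
      ⟨j, by omega, t, ht, hzj⟩ hz ?_
    · rintro x ⟨l, hl, r, hr, rfl⟩
      simp only [hmem, List.append_cancel_left_eq, List.cons.injEq]
      rintro _ _ ⟨rfl, rfl⟩
      simp [hr, hl]
    · rintro x ⟨l, hl, r, hr, rfl⟩
      rw [hzj]
      refine .of_strict_grandchildren hr ht fun i' r' h => ?_
      simp only [List.append_cancel_left_eq, List.cons.injEq] at h
      omega

variable (hc : IsComap φ.toFormula.symbols T' T (cutChildren p a d)) (hd : 0 < d)
include hc hd

theorem isViewFrom_left {u : List ℕ} (hu : ∀ i s, u = p ++ i :: s → i ≤ a) :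
    IsViewFrom φ.toFormula.symbols (φ.C + 1) T' T
      (Function.update (cutChildren p a d) (p ++ [a + 1]) (p ++ [a + 1])) u := by
  have hself : Function.update (cutChildren p a d) (p ++ [a + 1]) (p ++ [a + 1]) u = u := by
    rw [Function.update_of_ne, cutChildren_eq_self hu]
    rintro rfl
    have := hu (a + 1) [] rfl
    omega
  refine ⟨hc.update (x := ⟨_, halike.mem le_rfl⟩) (w := ⟨_, halike.mem (by omega)⟩)
    cutChildren_succ (notMem_range_cutChildren (by omega) (by omega)) halike.oneType_succ_eq,
    fun u' => ?_, fun z hz => ?_⟩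
  · rw [hself]
    exact sameRel_update_cutChildren_succ hu u'
  · rw [hself]
    exact halike.le_ncard_copies_left hu hz

theorem isViewFrom_right {i : ℕ} (hi : a < i) (s : List ℕ) :
    IsViewFrom φ.toFormula.symbols (φ.C + 1) T' T
      (Function.update (cutChildren p a d) (p ++ [a]) (p ++ [a + d])) (p ++ i :: s) := by
  have hself : Function.update (cutChildren p a d) (p ++ [a]) (p ++ [a + d]) (p ++ i :: s) =
      p ++ (i + d) :: s := by
    rw [Function.update_of_ne, cutChildren_of_lt hi]
    simp [hi.ne']
  refine ⟨hc.update (x := ⟨_, halike.mem (by omega)⟩) (w := ⟨_, halike.mem (by omega)⟩)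
    (cutChildren_of_le le_rfl) (notMem_range_cutChildren (by omega) le_rfl)
    halike.oneType_eq.symm, fun u' => ?_, fun z hz => ?_⟩
  · rw [hself]
    exact sameRel_update_cutChildren hi s u'
  · rw [hself]
    exact halike.le_ncard_copies_right hi s hz

omit hc in
theorem exists_model_card_lt (hT : T.Models φ.toFormula) :
    ∃ T' : TreeStructure U, T'.Models φ.toFormula ∧ T'.dom.card < T.dom.card := by
  obtain ⟨T', hc⟩ := T.exists_isComap_cutChildren (σ := φ.toFormula.symbols)
    (T.mem_of_append_mem (halike.mem (Nat.zero_le _))) a d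
  have hview (u : T'.Node) : ∃ h, IsViewFrom φ.toFormula.symbols (φ.C + 1) T' T h u.1 := by
    by_cases hu : ∃ i s, u.1 = p ++ i :: s ∧ a < i
    · obtain ⟨i, s, hu, hi⟩ := hu
      exact ⟨_, hu ▸ halike.isViewFrom_right hc hd hi s⟩
    · push Not at hu
      exact ⟨_, halike.isViewFrom_left hc hd hu⟩
  refine ⟨T', NormalForm.models_of_agree hT (fun u u' => ?_) (fun u => ?_),
    hc.card_lt (z := p ++ [a + 1]) (halike.mem (by omega))
      (notMem_range_cutChildren (by omega) (by omega))⟩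
  · obtain ⟨h, hv⟩ := hview u
    exact ⟨_, _, hv.agree (hv.sameRel u'.1)⟩
  · obtain ⟨h, hv⟩ := hview u
    exact ⟨_, hv.sameWitnessCounts⟩

end CutAlike

theorem TreeFrame.child_mem_of_lt_degree {T : TreeFrame} {v : T.Node} {j : ℕ}
    (h : j < T.degree v) : v.1 ++ [j] ∈ T.dom := by
  by_contra hj
  refine h.not_ge ?_
  have hsub : Subtype.val '' {w : T.Node | T.Child v w} ⊆ (fun k => v.1 ++ [k]) '' Set.Iio j := by
    rintro _ ⟨w, ⟨k, hk⟩, rfl⟩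
    exact ⟨k, not_le.1 fun hjk => hj (T.sibling_mem_of_le hjk (hk ▸ w.2)), hk.symm⟩
  calc T.degree v = (Subtype.val '' {w : T.Node | T.Child v w}).ncard :=
        (Set.ncard_image_of_injective _ Subtype.val_injective).symm
    _ ≤ ((fun k => v.1 ++ [k]) '' Set.Iio j).ncard :=
        Set.ncard_le_ncard hsub ((Set.finite_Iio j).image _)
    _ ≤ (Set.Iio j).ncard := Set.ncard_image_le (Set.finite_Iio j)
    _ = j := by simp

theorem degree_le_of_minimalFor
    (hT : MinimalFor (fun T : TreeStructure U => T.Models φ.toFormula) (fun T => T.dom.card) T)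
    (v : T.Node) :
    T.degree v ≤ φ.numOneTypes ^ 2 * (4 * φ.numOneTypes * (φ.C + 1) + 1) + 1 := by
  by_contra! hlarge
  have hmem {j : ℕ} (hj : j < T.degree v) : v.1 ++ [j] ∈ T.dom :=
    TreeFrame.child_mem_of_lt_degree hj
  let key (j : Fin (T.degree v - 1)) :
      oneTypes φ.toFormula.symbols × oneTypes φ.toFormula.symbols :=
    (T.oneType _ ⟨v.1 ++ [j.1], hmem (by omega)⟩, T.oneType _ ⟨v.1 ++ [j.1 + 1], hmem (by omega)⟩)
  obtain ⟨a, b, hab, hkey, hcounts⟩ := T.exists_lt_sameCounts (σ := φ.toFormula.symbols)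
    (k := φ.C + 1) key
    ![fun j => leftOf v.1 j, fun j => rightOf v.1 j, fun j => belowLeft v.1 j,
      fun j => belowRight v.1 j]
    (by
      simp only [Fin.forall_fin_succ, Matrix.cons_val_zero, Matrix.cons_val_succ]
      exact ⟨Or.inl fun _ _ h => leftOf_mono v.1 h, Or.inr fun _ _ h => rightOf_anti v.1 h,
        Or.inl fun _ _ h => belowLeft_mono v.1 h, Or.inr fun _ _ h => belowRight_anti v.1 h,
        fun i => i.elim0⟩)
    (by
      rw [Nat.card_prod, ← φ.numOneTypes_eq_card, ← pow_two, Nat.card_fin]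
      exact Nat.lt_sub_of_add_lt hlarge)
  obtain ⟨d, hd⟩ := Nat.exists_eq_add_of_le (Fin.le_def.1 hab.le)
  simp only [key, Prod.mk.injEq, hd] at hkey
  have halike : CutAlike φ T v.1 a d :=
    ⟨fun _ => hmem (by omega), hkey.1, hkey.2, hd ▸ hcounts 0, hd ▸ hcounts 1, hd ▸ hcounts 2,
      hd ▸ hcounts 3⟩
  obtain ⟨T', hT', hlt⟩ := halike.exists_model_card_lt (by omega) hT.prop
  exact hT.not_lt hT' hlt

end Cut
section Minimal

variable {U : Type*} {φ : NormalForm U} {T : TreeStructure U}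

/-- The tree structure that consists of the root of `T` only. -/
def TreeStructure.rootOnly (T : TreeStructure U) : TreeStructure U where
  dom := {[]}
  root_mem := Finset.mem_singleton_self []
  parent_mem := by simp
  left_mem := by simp
  pred A _ := T.pred A ⟨[], T.root_mem⟩

theorem TreeStructure.agree_rootOnly {σ : Set (U ⊕ Nav)} (T : TreeStructure U)
    (u u' : T.rootOnly.Node) :
    Agree σ T.rootOnly u u' T ⟨[], T.root_mem⟩ ⟨[], T.root_mem⟩ := by
  have hnil (u : T.rootOnly.Node) : u.1 = [] := Finset.mem_singleton.1 u.2
  refine .of_oneType_eq (oneType_eq_of_pred_iff fun _ _ => .rfl)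
    (oneType_eq_of_pred_iff fun _ _ => .rfl) ?_
  rw [hnil u, hnil u']
  exact .refl _ _

/-- Without a positive counting bound no conjunct asks for witnesses. -/
theorem TreeStructure.Models.rootOnly (hT : T.Models φ.toFormula) (hC : φ.C = 0) :
    T.rootOnly.Models φ.toFormula := by
  rw [NormalForm.models_iff] at hT ⊢
  refine ⟨fun u u' => ((T.agree_rootOnly u u').holds_iff φ.chi_qf φ.symbols_chi_subset).2
    (hT.1 _ _), fun i u => ?_⟩
  have hbound : φ.bound i = 0 := Nat.le_zero.1 (hC ▸ φ.bound_le_C i)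
  have hsat := hT.2 i ⟨[], T.root_mem⟩
  cases hcmp : φ.cmp i with
  | le =>
    simp only [hcmp, Cmp.Sat, hbound, Nat.le_zero, Set.ncard_eq_zero (Set.toFinite _)] at hsat ⊢
    refine Set.eq_empty_of_forall_notMem fun u' hu' => ?_
    exact Set.eq_empty_iff_forall_notMem.1 hsat _
      (((T.agree_rootOnly u u').holds_iff (φ.chiC_qf i) (φ.symbols_chiC_subset i)).1 hu')
  | ge => exact hbound.trans_le (Nat.zero_le _)

theorem degree_eq_zero_of_minimalFor
    (hT : MinimalFor (fun T : TreeStructure U => T.Models φ.toFormula) (fun T => T.dom.card) T)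
    (hC : φ.C = 0) (v : T.Node) : T.degree v = 0 := by
  have hcard : T.dom.card ≤ 1 := not_lt.1 (hT.not_lt (hT.prop.rootOnly hC))
  by_contra h
  have hchild := TreeFrame.child_mem_of_lt_degree (Nat.pos_of_ne_zero h)
  simpa using Finset.card_le_one.1 hcard _ hchild _ T.root_mem

theorem TreeStructure.numOneTypes_pos (T : TreeStructure U) (φ : NormalForm U) :
    0 < φ.numOneTypes := by
  have : Nonempty (oneTypes φ.toFormula.symbols) := ⟨T.oneType _ ⟨[], T.root_mem⟩⟩
  rw [φ.numOneTypes_eq_card]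
  exact Nat.card_pos

end Minimal

theorem length_bound_le {N : ℕ} (hN : 0 < N) (c m : ℕ) :
    N * (c + 2) ^ m * (3 * N * (c + 1) + 1) ≤ 3 * (c + 2) ^ (10 * m + 1) * N ^ 2 := by
  have hpow : (c + 2) ^ m ≤ (c + 2) ^ (10 * m) := Nat.pow_le_pow_right (by omega) (by omega)
  calc N * (c + 2) ^ m * (3 * N * (c + 1) + 1)
      ≤ N * (c + 2) ^ (10 * m) * (3 * N * (c + 2)) := by
        gcongr
        nlinarith
    _ = 3 * (c + 2) ^ (10 * m + 1) * N ^ 2 := by ring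

theorem degree_bound_le {N c : ℕ} (hN : 0 < N) (hc : 0 < c) :
    N ^ 2 * (4 * N * (c + 1) + 1) + 1 ≤ (4 * c ^ 2 + 8 * c) * N ^ 5 := by
  have hpow (k : ℕ) (hk : k ≤ 5) : N ^ k ≤ N ^ 5 := Nat.pow_le_pow_right hN hk
  calc N ^ 2 * (4 * N * (c + 1) + 1) + 1 = 4 * (c + 1) * N ^ 3 + N ^ 2 + N ^ 0 := by ring
    _ ≤ 4 * (c + 1) * N ^ 5 + N ^ 5 + N ^ 5 :=
        add_le_add_three (Nat.mul_le_mul_left _ (hpow 3 (by norm_num))) (hpow 2 (by norm_num))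
          (hpow 0 (by norm_num))
    _ = (4 * c + 6) * N ^ 5 := by ring
    _ ≤ (4 * c ^ 2 + 8 * c) * N ^ 5 := Nat.mul_le_mul_right _ (by nlinarith)

theorem theorem3 {U : Type*} (φ : NormalForm U) (hφ : φ.toFormula.Satisfiable) :
    ∃ T : TreeStructure U, T.Models φ.toFormula ∧
      (∀ P : List T.Node, T.IsDownPath P →
        P.length ≤ 3 * (φ.C + 2) ^ (10 * φ.m + 1) * φ.numOneTypes ^ 2) ∧
      (∀ v : T.Node, T.degree v ≤ (4 * φ.C ^ 2 + 8 * φ.C) * φ.numOneTypes ^ 5) := by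
  obtain ⟨T, hT⟩ := exists_minimalFor_of_wellFoundedLT
    (fun T : TreeStructure U => T.Models φ.toFormula) (fun T => T.dom.card) hφ
  have hN := T.numOneTypes_pos φ
  refine ⟨T, hT.prop, fun P hP => ?_, fun v => ?_⟩
  · exact (length_le_of_minimalFor hT hP).trans (length_bound_le hN φ.C φ.m)
  · rcases Nat.eq_zero_or_pos φ.C with hC | hC
    · exact (degree_eq_zero_of_minimalFor hT hC v).trans_le (Nat.zero_le _)
    · exact (degree_le_of_minimalFor hT v).trans (degree_bound_le hN hC)
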